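/- Let $n\ge 0$ be an integer. Write $z\cdot\overline w=\sum_k z_k\overline{w_k}$ and $|z|^2=z\cdot\overline z$ on $\mathbb C^n$, and let $d\mu(z)=\pi^{-n}e^{-|z|^2}\,dV(z)$, where $dV$ is Lebesgue measure. The Fock space is $F^2=L^2(\mathbb C^n,d\mu)\cap H(\mathbb C^n)$, where $H(\mathbb C^n)$ is the set of entire functions; its reproducing kernel is $K(w,z)=e^{w\cdot\overline z}$, and $k(w,z)=K(w,z)/\sqrt{K(z,z)}$. Let $\mathrm{Sym}(\mathbb C^n)$ be the set of measurable $\varphi:\mathbb C^n\to\mathbb C$ such that $\varphi(z)e^{-c|z|^2}$ is essentially bounded for every $c>0$. For a function $\varphi$, the Toeplitz operator is $T_\varphi h=P(\varphi h)$, where $P\psi(z)=\int \psi(w)K(z,w)\,d\mu(w)$ is the orthogonal projection of $L^2(\mathbb C^n,d\mu)$ onto $F^2$; its domain is $\mathrm{dom}(T_\varphi)=\{h\in F^2:\varphi h\in L^2(\mathbb C^n,d\mu)\}$. The product $T_\varphi T_\psi$ has domain $\{h\in\mathrm{dom}(T_\psi):T_\psi h\in\mathrm{dom}(T_\varphi)\}$,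 and $[T_\varphi,T_\psi]=0$ means that $T_\varphi T_\psi h=T_\psi T_\varphi h$ for every $h$ in the domains of both products. The Berezin transform is $\mathcal B[\varphi](z)=\int\varphi(w)\,|k(w,z)|^2\,d\mu(w)$. For $g\in H(\mathbb C^n)$ put $g^*(z)=\overline{g(\overline z)}$. For entire $p(z)=\sum_i a_iz^i$ (sum over multi-indices) and $f\in H(\mathbb C^n)$ put $$p(\overline z-\partial_z)f(z)=\sum_i a_i\,(\overline z-\partial_z)^if(z),\qquad (\overline z-\partial_z)^if(z)=\sum_{l\le i}\binom{i}{l}\,\overline z^{\,l}\,(-1)^{|i-l|}\,\partial^{i-l}f(z).$$ **Theorem.** Let $f,g,u,v\in\mathrm{Sym}(\mathbb C^n)\cap H(\mathbb C^n)$. Then the series $g^*(\overline z-\partial_z)u(z)$ and $v^*(\overline z-\partial_z)f(z)$ converge absolutely for every $z\in\mathbb C^n$, and the following statements are equivalent: (a) $[T_{f+\overline g},T_{u+\overline v}]=0$; (b) $\mathcal B[u\overline g-f\overline v]=u\overline g-f\overline v$ on $\mathbb C^n$; (c) $u(z)\overline{g(z)}-f(z)\overline{v(z)}=g^*(\overline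 z-\partial_z)u(z)-v^*(\overline z-\partial_z)f(z)$ for all $z\in\mathbb C^n$. -/

import Mathlib

open MeasureTheory
open scoped ComplexConjugate

noncomputable section

namespace Fock

variable {n : ℕ}

/-- The square `|z|² = ∑ₖ |zₖ|²` of the Euclidean norm on `ℂⁿ`. -/
def normSq (z : Fin n → ℂ) : ℝ := ∑ k, ‖z k‖ ^ 2

/-- The pairing `z · w̄ = ∑ₖ zₖ w̄ₖ` on `ℂⁿ`. -/
def pairing (z w : Fin n → ℂ) : ℂ := ∑ k, z k * conj (w k)

/-- The Gaussian measure `dμ(z) = π⁻ⁿ e^{-|z|²} dV(z)`, with `dV` Lebesgue measure on `ℂⁿ`. -/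
def gaussian (n : ℕ) : Measure (Fin n → ℂ) :=
  volume.withDensity fun z => ENNReal.ofReal ((Real.pi ^ n)⁻¹ * Real.exp (-normSq z))

/-- `H(ℂⁿ)`: the entire functions on `ℂⁿ`. -/
def entire (n : ℕ) : Set ((Fin n → ℂ) → ℂ) := {f | Differentiable ℂ f}

/-- `𝒟_c`: the measurable functions `u` with `u(z) e^{-c|z|²}` essentially bounded. -/
def growthClass (n : ℕ) (c : ℝ) : Set ((Fin n → ℂ) → ℂ) :=
  {u | Measurable u ∧ ∃ M : ℝ, ∀ᵐ z, ‖u z‖ * Real.exp (-c * normSq z) ≤ M}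

/-- `Sym(ℂⁿ) = ⋂_{c > 0} 𝒟_c`. -/
def Sym (n : ℕ) : Set ((Fin n → ℂ) → ℂ) := ⋂ c : {c : ℝ // 0 < c}, growthClass n c

/-- The Fock space `F² = L²(ℂⁿ, dμ) ∩ H(ℂⁿ)`. -/
def fockSpace (n : ℕ) : Set ((Fin n → ℂ) → ℂ) := {f | MemLp f 2 (gaussian n)} ∩ entire n

/-- The reproducing kernel `K(w, z) = e^{w · z̄}`. -/
def kernel (w z : Fin n → ℂ) : ℂ := Complex.exp (pairing w z)

/-- The normalized kernel `k(w, z) = K(w, z) / √K(z, z)` (`K(z, z) = e^{|z|²}` is positive). -/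
def normalizedKernel (w z : Fin n → ℂ) : ℂ := kernel w z / (Real.sqrt (kernel z z).re : ℂ)

/-- The projection `P` of `L²(dμ)` onto `F²`, `Pf(z) = ∫ f(w) K(z, w) dμ(w)`. -/
def proj (f : (Fin n → ℂ) → ℂ) : (Fin n → ℂ) → ℂ :=
  fun z => ∫ w, f w * kernel z w ∂(gaussian n)

/-- The Toeplitz operator `T_φ h = P(φ h)`. -/
def toeplitz (φ h : (Fin n → ℂ) → ℂ) : (Fin n → ℂ) → ℂ := proj fun w => φ w * h w

/-- The natural domain of `T_φ = P M_φ` in the Fock space: all `h ∈ F²` with `φ h ∈ L²(dμ)`. -/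
def toeplitzDomain (φ : (Fin n → ℂ) → ℂ) : Set ((Fin n → ℂ) → ℂ) :=
  {h | h ∈ fockSpace n ∧ MemLp (fun w => φ w * h w) 2 (gaussian n)}

/-- The natural domain of the product `T_φ T_ψ`. -/
def productDomain (φ ψ : (Fin n → ℂ) → ℂ) : Set ((Fin n → ℂ) → ℂ) :=
  {h | h ∈ toeplitzDomain ψ ∧ toeplitz ψ h ∈ toeplitzDomain φ}

/-- `[T_φ, T_ψ] = 0`: the commutator `T_φ T_ψ - T_ψ T_φ` vanishes on its natural domain
`dom (T_φ T_ψ) ∩ dom (T_ψ T_φ)`. -/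
def CommutatorEqZero (φ ψ : (Fin n → ℂ) → ℂ) : Prop :=
  ∀ h ∈ productDomain φ ψ ∩ productDomain ψ φ,
    toeplitz φ (toeplitz ψ h) - toeplitz ψ (toeplitz φ h) = 0

/-- The Berezin transform `𝓑[f](z) = ⟨f k(·, z), k(·, z)⟩` in `L²(dμ)`. -/
def berezin (f : (Fin n → ℂ) → ℂ) : (Fin n → ℂ) → ℂ :=
  fun z => ∫ w, f w * normalizedKernel w z * conj (normalizedKernel w z) ∂(gaussian n)

/-- `g*(z) = conj (g (z̄))`. -/
def starFun (g : (Fin n → ℂ) → ℂ) : (Fin n → ℂ) → ℂ := fun z => conj (g fun k => conj (z k))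

/-- The complex partial derivative `∂ₖ f` of a holomorphic function. -/
def partialDeriv (k : Fin n) (f : (Fin n → ℂ) → ℂ) : (Fin n → ℂ) → ℂ :=
  fun z => fderiv ℂ f z (Pi.single k 1)

/-- `∂^i = ∂₁^{i₁} ⋯ ∂ₙ^{iₙ}` for a multi-index `i`. -/
def multiDeriv (i : Fin n → ℕ) (f : (Fin n → ℂ) → ℂ) : (Fin n → ℂ) → ℂ :=
  (List.finRange n).foldr (fun k h => (partialDeriv k)^[i k] h) f

/-- The Taylor coefficient `a_i = ∂^i p(0) / i!`, so that `p(z) = ∑ᵢ a_i z^i` for `p` entire. -/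
def taylorCoeff (p : (Fin n → ℂ) → ℂ) (i : Fin n → ℕ) : ℂ :=
  multiDeriv i p 0 / ∏ k, ((i k).factorial : ℂ)

/-- `(z̄ - ∂_z)^i f(z) = ∑_{l ≤ i} C(i, l) z̄^l (-∂_z)^{i-l} f(z)` for a holomorphic `f`. -/
def conjSubDerivPow (i : Fin n → ℕ) (f : (Fin n → ℂ) → ℂ) (z : Fin n → ℂ) : ℂ :=
  ∑ l ∈ Finset.Iic i, (∏ k, ((i k).choose (l k) : ℂ)) * (∏ k, conj (z k) ^ l k) *
    ((∏ k, (-1 : ℂ) ^ (i k - l k)) * multiDeriv (i - l) f z)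

/-- The `i`-th term of the series `p(z̄ - ∂_z) f(z)`. -/
def conjSubDerivTerm (p f : (Fin n → ℂ) → ℂ) (z : Fin n → ℂ) (i : Fin n → ℕ) : ℂ :=
  taylorCoeff p i * conjSubDerivPow i f z

/-- `p(z̄ - ∂_z) f(z) = ∑ᵢ a_i (z̄ - ∂_z)^i f(z)` for entire `p(z) = ∑ᵢ a_i z^i` and `f`. -/
def conjSubDeriv (p f : (Fin n → ℂ) → ℂ) : (Fin n → ℂ) → ℂ :=
  fun z => ∑' i, conjSubDerivTerm p f z i

end Fock

end

noncomputable section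

namespace Fock

variable {n : ℕ}

lemma normSq_nonneg (z : Fin n → ℂ) : 0 ≤ normSq z :=
  Finset.sum_nonneg fun _ _ => by positivity

@[fun_prop]
lemma continuous_normSq : Continuous (normSq : (Fin n → ℂ) → ℝ) := by
  unfold normSq; fun_prop

lemma normSq_add_le (z w : Fin n → ℂ) : normSq (z + w) ≤ 2 * normSq z + 2 * normSq w := by
  simp only [normSq, Finset.mul_sum, ← Finset.sum_add_distrib, Pi.add_apply]
  refine Finset.sum_le_sum fun k _ => ?_
  have h := norm_add_le (z k) (w k)
  nlinarith [norm_nonneg (z k + w k), norm_nonneg (z k), norm_nonneg (w k),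
    sq_nonneg (‖z k‖ - ‖w k‖)]

lemma normSq_sub_le (z w : Fin n → ℂ) : normSq (z - w) ≤ 2 * normSq z + 2 * normSq w := by
  have h := normSq_add_le z (-w)
  have h2 : normSq (-w) = normSq w := by simp [normSq]
  rwa [← sub_eq_add_neg, h2] at h

@[simp]
lemma normSq_conj (z : Fin n → ℂ) : normSq (fun k => conj (z k)) = normSq z := by
  simp [normSq]

@[simp]
lemma normSq_smul (a : ℂ) (z : Fin n → ℂ) : normSq (a • z) = ‖a‖ ^ 2 * normSq z := by
  simp [normSq, mul_pow, Finset.mul_sum]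

lemma pairing_self (z : Fin n → ℂ) : pairing z z = (normSq z : ℂ) := by
  simp [pairing, normSq, Complex.mul_conj, Complex.normSq_eq_norm_sq]

lemma conj_pairing (z w : Fin n → ℂ) : conj (pairing z w) = pairing w z := by
  simp [pairing, mul_comm]

@[simp]
lemma conj_kernel (z w : Fin n → ℂ) : conj (kernel z w) = kernel w z := by
  rw [kernel, ← Complex.exp_conj, conj_pairing, kernel]

lemma kernel_self (z : Fin n → ℂ) : kernel z z = (Real.exp (normSq z) : ℂ) := by
  rw [kernel, pairing_self, Complex.ofReal_exp]

lemma kernel_ne_zero (z w : Fin n → ℂ) : kernel z w ≠ 0 := Complex.exp_ne_zero _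

lemma continuous_kernel : Continuous (fun p : (Fin n → ℂ) × (Fin n → ℂ) => kernel p.1 p.2) := by
  unfold kernel pairing; fun_prop

@[fun_prop]
lemma Continuous.kernel {X : Type*} [TopologicalSpace X] {f g : X → Fin n → ℂ}
    (hf : Continuous f) (hg : Continuous g) : Continuous (fun x => kernel (f x) (g x)) :=
  continuous_kernel.comp (hf.prodMk hg)

lemma sum_norm_mul_norm_le {c : ℝ} (hc : 0 < c) (z w : Fin n → ℂ) :
    ∑ k, ‖z k‖ * ‖w k‖ ≤ c * normSq z + (4 * c)⁻¹ * normSq w := by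
  simp only [normSq, Finset.mul_sum, ← Finset.sum_add_distrib]
  refine Finset.sum_le_sum fun k _ => ?_
  have h : c * ‖z k‖ ^ 2 + (4 * c)⁻¹ * ‖w k‖ ^ 2 - ‖z k‖ * ‖w k‖
      = c * (‖z k‖ - (2 * c)⁻¹ * ‖w k‖) ^ 2 := by
    field_simp; ring
  nlinarith [mul_nonneg hc.le (sq_nonneg (‖z k‖ - (2 * c)⁻¹ * ‖w k‖))]

lemma norm_pairing_le (z w : Fin n → ℂ) : ‖pairing z w‖ ≤ ∑ k, ‖z k‖ * ‖w k‖ :=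
  (norm_sum_le _ _).trans (by simp)

lemma norm_kernel_le {c : ℝ} (hc : 0 < c) (z w : Fin n → ℂ) :
    ‖kernel z w‖ ≤ Real.exp (c * normSq z + (4 * c)⁻¹ * normSq w) := by
  rw [kernel, Complex.norm_exp]
  exact Real.exp_le_exp.2 ((Complex.re_le_norm _).trans
    ((norm_pairing_le z w).trans (sum_norm_mul_norm_le hc z w)))

/-- Continuous functions that are `O(e^{c|z|²})`. -/
def GrowsAtMost (c : ℝ) (G : (Fin n → ℂ) → ℂ) : Prop :=
  Continuous G ∧ ∃ C : ℝ, ∀ z, ‖G z‖ ≤ C * Real.exp (c * normSq z)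

/-- Continuous functions that are `O(e^{c|z|²})` for every `c > 0`. -/
def SubGauss (G : (Fin n → ℂ) → ℂ) : Prop := ∀ c : ℝ, 0 < c → GrowsAtMost c G

namespace GrowsAtMost

variable {c d : ℝ} {G H : (Fin n → ℂ) → ℂ}

lemma mul (hG : GrowsAtMost c G) (hH : GrowsAtMost d H) :
    GrowsAtMost (c + d) (fun z => G z * H z) := by
  obtain ⟨hGc, C, hC⟩ := hG
  obtain ⟨hHc, D, hD⟩ := hH
  refine ⟨hGc.mul hHc, C * D, fun z => ?_⟩
  rw [norm_mul, add_mul, Real.exp_add]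
  calc ‖G z‖ * ‖H z‖ ≤ (C * Real.exp (c * normSq z)) * (D * Real.exp (d * normSq z)) :=
        mul_le_mul (hC z) (hD z) (norm_nonneg _) ((norm_nonneg _).trans (hC z))
    _ = _ := by ring

lemma nonneg_const (hG : GrowsAtMost c G) :
    ∃ C : ℝ, 0 ≤ C ∧ ∀ z, ‖G z‖ ≤ C * Real.exp (c * normSq z) := by
  obtain ⟨hGc, C, hC⟩ := hG
  exact ⟨|C|, abs_nonneg _, fun z => (hC z).trans (by gcongr; exact le_abs_self _)⟩

lemma mono (hG : GrowsAtMost c G) (h : c ≤ d) : GrowsAtMost d G := by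
  obtain ⟨C, hC0, hC⟩ := hG.nonneg_const
  exact ⟨hG.1, C, fun z => (hC z).trans (by gcongr; exact normSq_nonneg z)⟩

lemma add (hG : GrowsAtMost c G) (hH : GrowsAtMost c H) :
    GrowsAtMost c (fun z => G z + H z) := by
  obtain ⟨hGc, C, hC⟩ := hG
  obtain ⟨hHc, D, hD⟩ := hH
  exact ⟨hGc.add hHc, C + D, fun z => (norm_add_le _ _).trans (by
    rw [add_mul]; exact add_le_add (hC z) (hD z))⟩

lemma conjugate (hG : GrowsAtMost c G) : GrowsAtMost c (fun z => conj (G z)) :=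
  ⟨Complex.continuous_conj.comp hG.1, by simpa using hG.2⟩

end GrowsAtMost

namespace SubGauss

variable {c : ℝ} {G H : (Fin n → ℂ) → ℂ}

lemma continuous (hG : SubGauss G) : Continuous G := (hG 1 one_pos).1

lemma mul_growsAtMost (hG : SubGauss G) (hH : GrowsAtMost c H) {d : ℝ} (hd : c < d) :
    GrowsAtMost d (fun z => G z * H z) := by
  simpa using (hG (d - c) (sub_pos.2 hd)).mul hH

lemma mul (hG : SubGauss G) (hH : SubGauss H) : SubGauss (fun z => G z * H z) := fun _ hc =>
  hG.mul_growsAtMost (hH _ (half_pos hc)) (half_lt_self hc)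

lemma add (hG : SubGauss G) (hH : SubGauss H) : SubGauss (fun z => G z + H z) :=
  fun _ hc => (hG _ hc).add (hH _ hc)

lemma conjugate (hG : SubGauss G) : SubGauss (fun z => conj (G z)) := fun c hc => (hG c hc).conjugate

lemma const (a : ℂ) : SubGauss (fun _ : Fin n → ℂ => a) := fun _ hc =>
  ⟨continuous_const, ‖a‖, fun z => le_mul_of_one_le_right (norm_nonneg _)
    (Real.one_le_exp (mul_nonneg hc.le (normSq_nonneg z)))⟩

lemma sub (hG : SubGauss G) (hH : SubGauss H) : SubGauss (fun z => G z - H z) := by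
  simpa [sub_eq_add_neg] using hG.add ((const (-1)).mul hH)

lemma comp {A : (Fin n → ℂ) → Fin n → ℂ} (hG : SubGauss G) (hA : Continuous A) {a b : ℝ}
    (ha : 0 < a) (h : ∀ z, normSq (A z) ≤ a * normSq z + b) : SubGauss (fun z => G (A z)) := by
  intro c hc
  obtain ⟨C, hC0, hC⟩ := (hG (c / a) (div_pos hc ha)).nonneg_const
  refine ⟨hG.continuous.comp hA, C * Real.exp (c / a * b), fun z => (hC _).trans ?_⟩
  rw [mul_assoc, ← Real.exp_add]
  gcongr
  calc c / a * normSq (A z) ≤ c / a * (a * normSq z + b) := by gcongr; exact h z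
    _ = _ := by field_simp; ring

lemma comp_add_left (hG : SubGauss G) (z : Fin n → ℂ) : SubGauss (fun w => G (z + w)) :=
  hG.comp (by fun_prop) two_pos (b := 2 * normSq z) fun w => by linarith [normSq_add_le z w]

lemma kernel_left (z : Fin n → ℂ) : SubGauss (fun w => kernel z w) := fun c hc =>
  ⟨by fun_prop, Real.exp ((4 * c)⁻¹ * normSq z), fun w => by
    rw [← Real.exp_add, add_comm, ← RCLike.norm_conj, conj_kernel]; exact norm_kernel_le hc w z⟩

lemma kernel_right (z : Fin n → ℂ) : SubGauss (fun w => kernel w z) := by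
  simpa using (kernel_left z).conjugate

lemma coord (k : Fin n) : SubGauss (fun w : Fin n → ℂ => w k) := by
  intro c hc
  refine ⟨by fun_prop, 1 + c⁻¹, fun z => ?_⟩
  have h1 : ‖z k‖ ^ 2 ≤ normSq z :=
    Finset.single_le_sum (f := fun k => ‖z k‖ ^ 2) (fun _ _ => by positivity) (Finset.mem_univ k)
  have h2 : c * normSq z + 1 ≤ Real.exp (c * normSq z) := Real.add_one_le_exp _
  have h3 : normSq z ≤ c⁻¹ * Real.exp (c * normSq z) := by
    rw [inv_mul_eq_div, le_div_iff₀ hc]; linarith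
  have h4 : 1 ≤ Real.exp (c * normSq z) := Real.one_le_exp (mul_nonneg hc.le (normSq_nonneg z))
  nlinarith [sq_nonneg (‖z k‖ - 1), norm_nonneg (z k)]

lemma pow (hG : SubGauss G) (m : ℕ) : SubGauss (fun z => G z ^ m) := by
  induction m with
  | zero => simpa using const 1
  | succ m ih => simpa [pow_succ] using ih.mul hG

lemma prod {ι : Type*} (s : Finset ι) {F : ι → (Fin n → ℂ) → ℂ} (hF : ∀ i, SubGauss (F i)) :
    SubGauss (fun z => ∏ i ∈ s, F i z) := by
  classical
  induction s using Finset.induction_on with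
  | empty => simpa using const 1
  | insert i s hi ih => simpa [Finset.prod_insert hi] using (hF i).mul ih

end SubGauss

lemma subGauss_of_mem {f : (Fin n → ℂ) → ℂ} (hf : f ∈ Sym n ∩ entire n) : SubGauss f := by
  intro c hc
  have hfc : Continuous f := Differentiable.continuous hf.2
  obtain ⟨-, M, hM⟩ := Set.mem_iInter.1 hf.1 ⟨c, hc⟩
  refine ⟨hfc, M, fun z => ?_⟩
  have hopen : IsOpen {z | ¬ ‖f z‖ * Real.exp (-c * normSq z) ≤ M} := by
    simp only [not_le]
    exact isOpen_lt continuous_const (by fun_prop)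
  have hempty := (hopen.measure_eq_zero_iff volume).1 (ae_iff.1 hM)
  have hz : ‖f z‖ * Real.exp (-c * normSq z) ≤ M := by
    by_contra h
    exact Set.notMem_empty z (hempty ▸ h)
  calc ‖f z‖ = (‖f z‖ * Real.exp (-c * normSq z)) * Real.exp (c * normSq z) := by
        rw [mul_assoc, ← Real.exp_add]; simp
    _ ≤ _ := by gcongr

lemma exp_mul_normSq (a : ℝ) (z : Fin n → ℂ) :
    Real.exp (a * normSq z) = ∏ k, Real.exp (a * ‖z k‖ ^ 2) := by
  rw [← Real.exp_sum, normSq, Finset.mul_sum]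

lemma integrable_exp_neg_mul_normSq {a : ℝ} (ha : 0 < a) :
    Integrable (fun z : Fin n → ℂ => Real.exp (-a * normSq z)) := by
  simp_rw [exp_mul_normSq]
  refine Integrable.fintype_prod (f := fun _ (x : ℂ) => Real.exp (-a * ‖x‖ ^ 2)) fun _ => ?_
  have h := (GaussianFourier.integrable_cexp_neg_mul_sq_norm_add (b := (a : ℂ)) (V := ℂ)
    (by simpa using ha) 0 0).norm
  simpa [Complex.norm_exp, ← Complex.ofReal_pow] using h

lemma measurable_gaussian_density :
    Measurable fun z : Fin n → ℂ => ENNReal.ofReal ((Real.pi ^ n)⁻¹ * Real.exp (-normSq z)) :=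
  (by fun_prop : Continuous fun z : Fin n → ℂ =>
    (Real.pi ^ n)⁻¹ * Real.exp (-normSq z)).measurable.ennreal_ofReal

lemma integral_gaussian {E : Type*} [NormedAddCommGroup E] [NormedSpace ℝ E]
    (G : (Fin n → ℂ) → E) :
    ∫ z, G z ∂(gaussian n) = ∫ z, ((Real.pi ^ n)⁻¹ * Real.exp (-normSq z)) • G z := by
  rw [gaussian, integral_withDensity_eq_integral_toReal_smul measurable_gaussian_density (by simp)]
  congr with z
  rw [ENNReal.toReal_ofReal (by positivity)]

lemma integrable_gaussian_iff {E : Type*} [NormedAddCommGroup E] [NormedSpace ℝ E]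
    {G : (Fin n → ℂ) → E} : Integrable G (gaussian n) ↔
      Integrable (fun z => ((Real.pi ^ n)⁻¹ * Real.exp (-normSq z)) • G z) := by
  rw [gaussian, integrable_withDensity_iff_integrable_smul' measurable_gaussian_density (by simp)]
  refine iff_of_eq (congrArg (Integrable · volume) (funext fun z => ?_))
  rw [ENNReal.toReal_ofReal (by positivity)]

instance isProbabilityMeasure_gaussian : IsProbabilityMeasure (gaussian n) := by
  constructor
  have h1 : ∫ z : Fin n → ℂ, (Real.pi ^ n)⁻¹ * Real.exp (-normSq z) = 1 := by
    rw [integral_const_mul]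
    have h : ∀ z : Fin n → ℂ, Real.exp (-normSq z) = ∏ k, Real.exp (-1 * ‖z k‖ ^ 2) := fun z => by
      rw [← exp_mul_normSq]; simp
    simp_rw [h]
    rw [integral_fintype_prod_volume_eq_prod (fun (_ : Fin n) (x : ℂ) => Real.exp (-1 * ‖x‖ ^ 2)),
      GaussianFourier.integral_rexp_neg_mul_sq_norm one_pos]
    simp [Complex.finrank_real_complex, Real.pi_ne_zero]
  have hint : Integrable fun z : Fin n → ℂ => (Real.pi ^ n)⁻¹ * Real.exp (-normSq z) := by
    simpa using (integrable_exp_neg_mul_normSq (n := n) one_pos).const_mul (Real.pi ^ n)⁻¹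
  rw [gaussian, withDensity_apply _ MeasurableSet.univ, setLIntegral_univ,
    ← ofReal_integral_eq_lintegral_ofReal hint (.of_forall fun z => by positivity), h1,
    ENNReal.ofReal_one]

lemma integrable_exp_mul_normSq {c : ℝ} (hc : c < 1) :
    Integrable (fun z => Real.exp (c * normSq z)) (gaussian n) := by
  rw [integrable_gaussian_iff]
  convert (integrable_exp_neg_mul_normSq (n := n) (sub_pos.2 hc)).const_mul (Real.pi ^ n)⁻¹
    using 2 with z
  rw [smul_eq_mul, mul_assoc, ← Real.exp_add]
  ring_nf

lemma GrowsAtMost.integrable {c : ℝ} {G : (Fin n → ℂ) → ℂ} (hG : GrowsAtMost c G) (hc : c < 1) :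
    Integrable G (gaussian n) := by
  obtain ⟨hGc, C, hC⟩ := hG
  exact ((integrable_exp_mul_normSq hc).const_mul C).mono' hGc.aestronglyMeasurable
    (.of_forall hC)

lemma SubGauss.integrable {G : (Fin n → ℂ) → ℂ} (hG : SubGauss G) : Integrable G (gaussian n) :=
  (hG 2⁻¹ (by norm_num)).integrable (by norm_num)

lemma SubGauss.memLp {G : (Fin n → ℂ) → ℂ} (hG : SubGauss G) : MemLp G 2 (gaussian n) := by
  rw [memLp_two_iff_integrable_sq_norm hG.continuous.aestronglyMeasurable]
  simpa using (hG.pow 2).integrable.norm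

lemma measurePreserving_smul_gaussian {a : ℂ} (ha : ‖a‖ = 1) :
    MeasurePreserving (fun z : Fin n → ℂ => a • z) (gaussian n) (gaussian n) := by
  have hvol : MeasurePreserving (fun z : Fin n → ℂ => a • z) volume volume := by
    have := volume_preserving_pi (ι := Fin n) (f := fun _ (x : ℂ) => a * x) fun _ =>
      (rotation ⟨a, by simpa [Submonoid.unitSphere] using ha⟩).measurePreserving
    exact this
  refine ⟨hvol.measurable, ?_⟩
  ext s hs
  rw [Measure.map_apply hvol.measurable hs, gaussian, withDensity_apply _ hs,
    withDensity_apply _ (hvol.measurable hs), ← hvol.setLIntegral_comp_preimage hs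
      measurable_gaussian_density]
  simp [ha]

lemma integral_gaussian_eq_apply_zero {G : (Fin n → ℂ) → ℂ} (hG : Differentiable ℂ G)
    (hi : Integrable G (gaussian n)) : ∫ w, G w ∂(gaussian n) = G 0 := by
  have hpi : (0 : ℝ) ≤ 2 * Real.pi := by positivity
  have hcirc : ∀ θ : ℝ, ‖circleMap 0 1 θ‖ = 1 := fun θ => by simp
  have hc : Continuous fun p : ℝ × (Fin n → ℂ) => G (circleMap 0 1 p.1 • p.2) :=
    hG.continuous.comp (((continuous_circleMap 0 1).comp continuous_fst).smul continuous_snd)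
  have hrot : ∀ θ : ℝ, ∫ w, G (circleMap 0 1 θ • w) ∂(gaussian n) = ∫ w, G w ∂(gaussian n) :=
    fun θ => (measurePreserving_smul_gaussian (hcirc θ)).integral_comp
      (measurableEmbedding_const_smul₀ (by simp)) G
  have havg : ∀ w, (2 * Real.pi)⁻¹ • ∫ θ in (0 : ℝ)..2 * Real.pi, G (circleMap 0 1 θ • w) = G 0 := by
    intro w
    have hd : Differentiable ℂ fun t : ℂ => G (t • w) := hG.comp (by fun_prop)
    simpa [Real.circleAverage] using
      (hd.diffContOnCl (s := Metric.ball (0 : ℂ) |1|)).circleAverage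
  have hint : Integrable (Function.uncurry fun (w : Fin n → ℂ) (θ : ℝ) => G (circleMap 0 1 θ • w))
      ((gaussian n).prod (volume.restrict (Set.Ioc 0 (2 * Real.pi)))) := by
    rw [← integrable_swap_iff,
      integrable_prod_iff (f := _ ∘ Prod.swap) (by exact hc.aestronglyMeasurable)]
    refine ⟨.of_forall fun θ => (measurePreserving_smul_gaussian (hcirc θ)).integrable_comp_of_integrable hi, ?_⟩
    have : ∀ θ : ℝ, ∫ w, ‖G (circleMap 0 1 θ • w)‖ ∂(gaussian n) = ∫ w, ‖G w‖ ∂(gaussian n) :=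
      fun θ => (measurePreserving_smul_gaussian (hcirc θ)).integral_comp
        (measurableEmbedding_const_smul₀ (by simp)) (‖G ·‖)
    simp only [Function.comp_apply, Prod.swap, Function.uncurry, this]
    exact integrable_const _
  calc ∫ w, G w ∂(gaussian n)
      = (2 * Real.pi)⁻¹ • ∫ _θ in (0 : ℝ)..2 * Real.pi, ∫ w, G w ∂(gaussian n) := by
        rw [intervalIntegral.integral_const, sub_zero, smul_smul, inv_mul_cancel₀ (by positivity),
          one_smul]
    _ = (2 * Real.pi)⁻¹ • ∫ θ in (0 : ℝ)..2 * Real.pi,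
          ∫ w, G (circleMap 0 1 θ • w) ∂(gaussian n) := by simp_rw [hrot]
    _ = ∫ w, ((2 * Real.pi)⁻¹ • ∫ θ in (0 : ℝ)..2 * Real.pi, G (circleMap 0 1 θ • w))
          ∂(gaussian n) := by
        simp_rw [intervalIntegral.integral_of_le hpi]
        rw [← integral_integral_swap hint, integral_smul]
    _ = G 0 := by simp_rw [havg]; simp

lemma exp_mul_kernel_mul_kernel (z w : Fin n → ℂ) :
    (Real.exp (-normSq (z + w)) : ℂ) * (kernel z (z + w) * kernel (z + w) z)
      = Real.exp (normSq z) * Real.exp (-normSq w) := by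
  simp only [kernel, Complex.ofReal_exp, ← Complex.exp_add, Complex.ofReal_neg, ← pairing_self]
  congr 1
  simp only [pairing, ← Finset.sum_neg_distrib, ← Finset.sum_add_distrib]
  refine Finset.sum_congr rfl fun k _ => ?_
  simp
  ring

lemma density_smul_translate (G : (Fin n → ℂ) → ℂ) (z w : Fin n → ℂ) :
    ((Real.pi ^ n)⁻¹ * Real.exp (-normSq (z + w))) •
        (G (z + w) * (kernel z (z + w) * kernel (z + w) z)) =
      (Real.exp (normSq z) : ℂ) * (((Real.pi ^ n)⁻¹ * Real.exp (-normSq w)) • G (z + w)) := by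
  have h := exp_mul_kernel_mul_kernel z w
  simp only [Complex.real_smul, Complex.ofReal_mul] at h ⊢
  linear_combination ((Real.pi ^ n)⁻¹ : ℝ) * G (z + w) * h

lemma integral_mul_kernel_mul_kernel (G : (Fin n → ℂ) → ℂ) (z : Fin n → ℂ) :
    ∫ w, G w * (kernel z w * kernel w z) ∂(gaussian n)
      = Real.exp (normSq z) * ∫ w, G (z + w) ∂(gaussian n) := by
  rw [integral_gaussian, integral_gaussian, ← integral_add_left_eq_self _ z, ← integral_const_mul]
  simp_rw [density_smul_translate]

lemma Integrable.of_mul_kernel_mul_kernel {G : (Fin n → ℂ) → ℂ} {z : Fin n → ℂ}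
    (h : Integrable (fun w => G w * (kernel z w * kernel w z)) (gaussian n)) :
    Integrable (fun w => G (z + w)) (gaussian n) := by
  rw [integrable_gaussian_iff] at h ⊢
  have h2 := h.comp_add_left z
  simp_rw [density_smul_translate] at h2
  simpa [← mul_assoc, ← Complex.exp_neg, ← Complex.exp_add] using
    h2.const_mul (Real.exp (-normSq z) : ℂ)

lemma differentiable_kernel_left (z : Fin n → ℂ) : Differentiable ℂ fun w => kernel w z := by
  unfold kernel pairing; fun_prop

/-- The reproducing property of `K`. -/
lemma integral_mul_kernel {H : (Fin n → ℂ) → ℂ} (hH : Differentiable ℂ H) {z : Fin n → ℂ}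
    (hi : Integrable (fun w => H w * kernel z w) (gaussian n)) :
    ∫ w, H w * kernel z w ∂(gaussian n) = H z := by
  have h0 : ∀ w, H w * kernel z w = H w * (kernel w z)⁻¹ * (kernel z w * kernel w z) := fun w => by
    linear_combination -(H w * kernel z w) * inv_mul_cancel₀ (kernel_ne_zero w z)
  have hd : Differentiable ℂ fun w => H (z + w) * (kernel (z + w) z)⁻¹ :=
    (hH.comp (differentiable_id.const_add z)).mul
      (((differentiable_kernel_left z).comp (differentiable_id.const_add z)).inv
        fun w => kernel_ne_zero _ _)
  have hi' := Integrable.of_mul_kernel_mul_kernel (G := fun w => H w * (kernel w z)⁻¹) (z := z)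
    (by simpa only [h0] using hi)
  rw [integral_congr_ae (.of_forall h0),
    integral_mul_kernel_mul_kernel (fun w => H w * (kernel w z)⁻¹),
    integral_gaussian_eq_apply_zero hd hi', add_zero, kernel_self]
  have he : (Real.exp (normSq z) : ℂ) ≠ 0 := by simp
  linear_combination H z * mul_inv_cancel₀ he

lemma SubGauss.integral_mul_kernel {H : (Fin n → ℂ) → ℂ} (hs : SubGauss H)
    (hH : Differentiable ℂ H) (z : Fin n → ℂ) : ∫ w, H w * kernel z w ∂(gaussian n) = H z :=
  Fock.integral_mul_kernel hH (hs.mul (.kernel_left z)).integrable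

lemma differentiable_integral_of_dominated {X : Type*} [MeasurableSpace X] {μ : Measure X}
    {F : ℂ → X → ℂ} (hd : ∀ w, Differentiable ℂ fun t => F t w)
    (hm : ∀ t, AEStronglyMeasurable (F t) μ)
    (hb : ∀ R : ℝ, ∃ B : X → ℝ, Integrable B μ ∧ ∀ t, ‖t‖ ≤ R → ∀ w, ‖F t w‖ ≤ B w) :
    Differentiable ℂ fun t => ∫ w, F t w ∂μ := by
  intro t
  obtain ⟨B, hB, hFB⟩ := hb (‖t‖ + 2)
  refine (hasDerivAt_integral_of_dominated_loc_of_deriv_le (s := Metric.ball t 1)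
    (F' := fun s w => deriv (fun s => F s w) s) (bound := B)
    (Metric.ball_mem_nhds t one_pos) (.of_forall hm)
    (hB.mono' (hm t) (.of_forall (hFB t (by linarith)))) ?_
    (.of_forall fun w s hs => ?_) hB
    (.of_forall fun w s _ => (hd w s).hasDerivAt)).2.differentiableAt
  · have hlim : Filter.Tendsto (fun m : ℕ => t + ((1 : ℂ) / ((m : ℂ) + 1))) Filter.atTop
        (nhdsWithin t {t}ᶜ) := by
      rw [tendsto_nhdsWithin_iff]
      refine ⟨by simpa using (tendsto_one_div_add_atTop_nhds_zero_nat (𝕜 := ℂ)).const_add t,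
        .of_forall fun m => ?_⟩
      have : (m : ℂ) + 1 ≠ 0 := by exact_mod_cast m.succ_ne_zero
      simpa using this
    refine aestronglyMeasurable_of_tendsto_ae Filter.atTop
      (f := fun (m : ℕ) w => slope (fun s => F s w) t (t + ((1 : ℂ) / ((m : ℂ) + 1))))
      (fun m => ?_) (.of_forall fun w => (hasDerivAt_iff_tendsto_slope.1 (hd w t).hasDerivAt).comp hlim)
    simp only [slope_def_module]
    exact ((hm _).sub (hm _)).const_smul (_ : ℂ)
  · have := Complex.norm_deriv_le_of_forall_mem_sphere_norm_le one_pos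
      ((hd w).diffContOnCl (s := Metric.ball s 1)) (fun r hr => hFB r ?_ w)
    · simpa using this
    · rw [mem_sphere_iff_norm] at hr
      rw [mem_ball_iff_norm] at hs
      linarith [norm_le_norm_add_norm_sub' r s, norm_le_norm_add_norm_sub' s t]

lemma SubGauss.norm {G : (Fin n → ℂ) → ℂ} (hG : SubGauss G) :
    SubGauss fun z => ((‖G z‖ : ℝ) : ℂ) := fun c hc =>
  ⟨by have := hG.continuous; fun_prop, by simpa using (hG c hc).2⟩

lemma SubGauss.sum {ι : Type*} (s : Finset ι) {F : ι → (Fin n → ℂ) → ℂ} (hF : ∀ i, SubGauss (F i)) :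
    SubGauss (fun z => ∑ i ∈ s, F i z) := by
  classical
  induction s using Finset.induction_on with
  | empty => simpa using const 0
  | insert i s hi ih => simpa [Finset.sum_insert hi] using (hF i).add ih

/-- The functional `z ↦ z · w̄`. -/
def pairingCLM (w : Fin n → ℂ) : (Fin n → ℂ) →L[ℂ] ℂ :=
  ∑ k, conj (w k) • ContinuousLinearMap.proj (R := ℂ) (φ := fun _ : Fin n => ℂ) k

lemma pairingCLM_apply (w z : Fin n → ℂ) : pairingCLM w z = pairing z w := by
  simp [pairingCLM, pairing, mul_comm]

lemma norm_pairingCLM_le (w : Fin n → ℂ) : ‖pairingCLM w‖ ≤ ∑ k, ‖w k‖ := by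
  refine ContinuousLinearMap.opNorm_le_bound _ (by positivity) fun z => ?_
  rw [pairingCLM_apply, Finset.sum_mul]
  refine (norm_sum_le _ _).trans (Finset.sum_le_sum fun k _ => ?_)
  rw [norm_mul, RCLike.norm_conj, mul_comm]
  gcongr
  exact norm_le_pi_norm z k

lemma hasFDerivAt_integral_mul_kernel {G : (Fin n → ℂ) → ℂ} (hG : SubGauss G) (z : Fin n → ℂ) :
    Integrable (fun w => (G w * kernel z w) • pairingCLM w) (gaussian n) ∧
    HasFDerivAt (fun z => ∫ w, G w * kernel z w ∂(gaussian n))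
      (∫ w, (G w * kernel z w) • pairingCLM w ∂(gaussian n)) z := by
  set B : (Fin n → ℂ) → ℝ := fun w => Real.exp (normSq z + 1) *
    ‖G w * (∑ k, ((‖w k‖ : ℝ) : ℂ)) * Real.exp (4⁻¹ * normSq w)‖ with hBdef
  have hB : Integrable B (gaussian n) := by
    have h1 : SubGauss fun w : Fin n → ℂ => G w * (∑ k, ((‖w k‖ : ℝ) : ℂ)) :=
      hG.mul (SubGauss.sum _ fun k => (SubGauss.coord k).norm)
    have h2 : GrowsAtMost (4⁻¹) fun w : Fin n → ℂ => (Real.exp (4⁻¹ * normSq w) : ℂ) :=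
      ⟨by fun_prop, 1, fun w => by simp [-Complex.ofReal_exp]⟩
    exact ((h1.mul_growsAtMost h2 (d := 2⁻¹) (by norm_num)).integrable (by norm_num)).norm.const_mul _
  have hle : ∀ w, ∀ y ∈ {y | normSq y < normSq z + 1},
      ‖(G w * kernel y w) • pairingCLM w‖ ≤ B w := by
    intro w y hy
    have hk := norm_kernel_le one_pos y w
    have hy : normSq y < normSq z + 1 := hy
    have hk2 : ‖kernel y w‖ ≤ Real.exp (normSq z + 1) * Real.exp (4⁻¹ * normSq w) := by
      rw [← Real.exp_add]
      refine hk.trans (Real.exp_le_exp.2 ?_)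
      norm_num
      linarith
    have hs : ‖(∑ k, ((‖w k‖ : ℝ) : ℂ))‖ = ∑ k, ‖w k‖ := by
      rw [← Complex.ofReal_sum, Complex.norm_real, Real.norm_of_nonneg (by positivity)]
    rw [norm_smul, norm_mul, hBdef]
    simp only [norm_mul, hs, Complex.norm_real, Real.norm_eq_abs, Real.abs_exp]
    calc ‖G w‖ * ‖kernel y w‖ * ‖pairingCLM w‖
        ≤ ‖G w‖ * (Real.exp (normSq z + 1) * Real.exp (4⁻¹ * normSq w)) * ∑ k, ‖w k‖ := by
          gcongr; exact norm_pairingCLM_le w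
      _ = _ := by ring
  have hcont : ∀ y, Continuous fun w => (G w * kernel y w) • pairingCLM w := fun y => by
    have := hG.continuous
    unfold pairingCLM
    fun_prop
  have hzmem : z ∈ {y | normSq y < normSq z + 1} := by simp
  refine ⟨hB.mono' (hcont z).aestronglyMeasurable (.of_forall fun w => hle w z hzmem), ?_⟩
  refine hasFDerivAt_integral_of_dominated_of_fderiv_le (s := {y | normSq y < normSq z + 1})
    (bound := B) (F' := fun y w => (G w * kernel y w) • pairingCLM w)
    ((isOpen_lt continuous_normSq continuous_const).mem_nhds hzmem)
    (.of_forall fun y => (hG.mul (.kernel_left y)).continuous.aestronglyMeasurable)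
    (hG.mul (.kernel_left z)).integrable
    (hcont z).aestronglyMeasurable (.of_forall hle) hB (.of_forall fun w y _ => ?_)
  have h1 : HasFDerivAt (fun y => kernel y w) (kernel y w • pairingCLM w) y := by
    have := (pairingCLM w).hasFDerivAt (x := y) |>.cexp
    simp only [pairingCLM_apply] at this
    exact this
  simpa [smul_smul] using h1.const_mul (G w)

lemma partialDeriv_integral_mul_kernel {G : (Fin n → ℂ) → ℂ} (hG : SubGauss G) (k : Fin n) :
    partialDeriv k (fun z => ∫ w, G w * kernel z w ∂(gaussian n))
      = fun z => ∫ w, G w * conj (w k) * kernel z w ∂(gaussian n) := by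
  funext z
  obtain ⟨h1, h2⟩ := hasFDerivAt_integral_mul_kernel hG z
  rw [partialDeriv, h2.fderiv, ContinuousLinearMap.integral_apply h1]
  congr with w
  have : pairing (Pi.single k 1) w = conj (w k) := by
    simp [pairing, Pi.single_apply]
  simp only [smul_apply, pairingCLM_apply, this, smul_eq_mul]
  ring

lemma iterate_partialDeriv_integral_mul_kernel {G : (Fin n → ℂ) → ℂ} (hG : SubGauss G) (k : Fin n)
    (m : ℕ) : (partialDeriv k)^[m] (fun z => ∫ w, G w * kernel z w ∂(gaussian n))
      = fun z => ∫ w, G w * conj (w k) ^ m * kernel z w ∂(gaussian n) := by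
  induction m with
  | zero => simp
  | succ m ih =>
    rw [Function.iterate_succ_apply', ih, partialDeriv_integral_mul_kernel
      (hG.mul ((SubGauss.coord k).conjugate.pow m))]
    simp_rw [pow_succ, mul_assoc]

lemma foldr_partialDeriv_integral_mul_kernel {G : (Fin n → ℂ) → ℂ} (hG : SubGauss G)
    (i : Fin n → ℕ) (L : List (Fin n)) :
    SubGauss (fun w => G w * (L.map fun k => conj (w k) ^ i k).prod) ∧
    L.foldr (fun k h => (partialDeriv k)^[i k] h)
        (fun z => ∫ w, G w * kernel z w ∂(gaussian n))
      = fun z => ∫ w, G w * (L.map fun k => conj (w k) ^ i k).prod * kernel z w ∂(gaussian n) := by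
  induction L with
  | nil => simpa using hG
  | cons k L ih =>
    have h : (fun w => G w * ((k :: L).map fun k => conj (w k) ^ i k).prod)
        = fun w => G w * (L.map fun k => conj (w k) ^ i k).prod * conj (w k) ^ i k := by
      funext w; simp; ring
    refine ⟨h ▸ ih.1.mul ((SubGauss.coord k).conjugate.pow (i k)), ?_⟩
    rw [List.foldr_cons, ih.2, iterate_partialDeriv_integral_mul_kernel ih.1]
    funext z
    exact integral_congr_ae (.of_forall fun w => by
      simp only [List.map_cons, List.prod_cons]; ring)

lemma partialDeriv_comp_add_left (k : Fin n) (f : (Fin n → ℂ) → ℂ) (z : Fin n → ℂ) :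
    partialDeriv k (fun w => f (z + w)) = fun w => partialDeriv k f (z + w) := by
  funext w
  simp [partialDeriv, fderiv_comp_add_left]

lemma multiDeriv_comp_add_left (i : Fin n → ℕ) (f : (Fin n → ℂ) → ℂ) (z : Fin n → ℂ) :
    multiDeriv i (fun w => f (z + w)) = fun w => multiDeriv i f (z + w) := by
  have hit : ∀ (k : Fin n) (m : ℕ) (f : (Fin n → ℂ) → ℂ),
      (partialDeriv k)^[m] (fun w => f (z + w)) = fun w => (partialDeriv k)^[m] f (z + w) := by
    intro k m
    induction m with
    | zero => simp
    | succ m ih => intro f; rw [Function.iterate_succ_apply, partialDeriv_comp_add_left, ih]; rfl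
  unfold multiDeriv
  induction List.finRange n with
  | nil => rfl
  | cons k L ih => simp only [List.foldr_cons, ih, hit]

lemma multiDeriv_eq_integral {u : (Fin n → ℂ) → ℂ} (hu : SubGauss u) (hd : Differentiable ℂ u)
    (i : Fin n → ℕ) (z : Fin n → ℂ) :
    multiDeriv i u z = ∫ w, u (z + w) * ∏ k, conj (w k) ^ i k ∂(gaussian n) := by
  have hU := hu.comp_add_left z
  have hrep : (fun w => u (z + w))
      = fun y => ∫ w, u (z + w) * kernel y w ∂(gaussian n) := by
    funext y
    exact (hU.integral_mul_kernel (hd.comp (differentiable_id.const_add z)) y).symm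
  have h0 : multiDeriv i u z = multiDeriv i (fun w => u (z + w)) 0 := by
    rw [multiDeriv_comp_add_left]; simp
  rw [h0, hrep, multiDeriv, (foldr_partialDeriv_integral_mul_kernel hU i _).2]
  simp [Fin.prod_univ_def, kernel, pairing]

lemma prod_sub_pow (i : Fin n → ℕ) (x y : Fin n → ℂ) :
    ∏ k, (x k - y k) ^ i k = ∑ l ∈ Finset.Iic i, (∏ k, ((i k).choose (l k) : ℂ)) *
      (∏ k, x k ^ l k) * ((∏ k, (-1 : ℂ) ^ (i k - l k)) * ∏ k, y k ^ (i - l) k) := by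
  have h : Finset.Iic i = Fintype.piFinset fun k => Finset.range (i k + 1) := by
    ext l
    simp [Pi.le_def]
  simp_rw [h, sub_eq_add_neg, add_pow, Finset.prod_univ_sum]
  refine Finset.sum_congr rfl fun l _ => ?_
  simp only [← Finset.prod_mul_distrib]
  refine Finset.prod_congr rfl fun k _ => ?_
  rw [Pi.sub_apply, neg_pow]
  ring

lemma conjSubDerivPow_eq_integral {u : (Fin n → ℂ) → ℂ} (hu : SubGauss u)
    (hd : Differentiable ℂ u) (i : Fin n → ℕ) (z : Fin n → ℂ) :
    conjSubDerivPow i u z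
      = ∫ w, u (z + w) * ∏ k, (conj (z k) - conj (w k)) ^ i k ∂(gaussian n) := by
  simp_rw [prod_sub_pow, conjSubDerivPow, multiDeriv_eq_integral hu hd, Finset.mul_sum]
  rw [integral_finsetSum]
  · refine Finset.sum_congr rfl fun l _ => ?_
    rw [← integral_const_mul, ← integral_const_mul]
    exact integral_congr_ae (.of_forall fun w => by ring)
  · intro l _
    exact ((hu.comp_add_left z).mul ((SubGauss.const _).mul ((SubGauss.const _).mul
      (SubGauss.prod _ fun k => (SubGauss.coord k).conjugate.pow _)))).integrable

lemma hasSum_prod_pi {𝕜 : Type*} [RCLike 𝕜] {n : ℕ} {a : Fin n → ℕ → 𝕜} {s : Fin n → 𝕜}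
    (h : ∀ k, HasSum (a k) (s k)) (hn : ∀ k, Summable fun m => ‖a k m‖) :
    (Summable fun i : Fin n → ℕ => ‖∏ k, a k (i k)‖) ∧
      HasSum (fun i : Fin n → ℕ => ∏ k, a k (i k)) (∏ k, s k) := by
  induction n with
  | zero =>
    refine ⟨(hasSum_unique _).summable, ?_⟩
    convert hasSum_unique (fun i : Fin 0 → ℕ => ∏ k, a k (i k)) using 1
    simp
  | succ n ih =>
    obtain ⟨h1, h2⟩ := ih (fun k => h k.succ) fun k => hn k.succ
    have hs := summable_mul_of_summable_norm (hn 0) h1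
    have hsn : Summable fun p : ℕ × (Fin n → ℕ) => ‖a 0 p.1 * ∏ k, a k.succ (p.2 k)‖ := by
      simpa using (hn 0).mul_of_nonneg h1 (fun _ => norm_nonneg _) fun _ => norm_nonneg _
    have hp := (h 0).mul h2 hs
    rw [← (Fin.consEquiv fun _ : Fin (n + 1) => ℕ).summable_iff,
      ← (Fin.consEquiv fun _ : Fin (n + 1) => ℕ).hasSum_iff]
    simp only [Function.comp_def, Fin.prod_univ_succ, Fin.consEquiv_apply, Fin.cons_zero,
      Fin.cons_succ]
    exact ⟨hsn, hp⟩

lemma hasSum_prod_pow_div_factorial (x : Fin n → ℂ) :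
    HasSum (fun i : Fin n → ℕ => ∏ k, x k ^ i k / ((i k).factorial : ℂ))
      (Complex.exp (∑ k, x k)) := by
  rw [Complex.exp_sum]
  refine (hasSum_prod_pi (a := fun k m => x k ^ m / (m.factorial : ℂ)) (fun k => ?_) fun k => ?_).2
  · rw [Complex.exp_eq_exp_ℂ]
    exact NormedSpace.expSeries_div_hasSum_exp (x k)
  · exact NormedSpace.norm_expSeries_div_summable (𝔸 := ℂ) (x k)

lemma sum_prod_pow_div_factorial_le (s : Finset (Fin n → ℕ)) {x : Fin n → ℝ} (hx : ∀ k, 0 ≤ x k) :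
    ∑ i ∈ s, ∏ k, x k ^ i k / ((i k).factorial : ℝ) ≤ Real.exp (∑ k, x k) := by
  have h : HasSum (fun i : Fin n → ℕ => ∏ k, x k ^ i k / ((i k).factorial : ℝ))
      (Real.exp (∑ k, x k)) := by
    rw [← Complex.hasSum_ofReal]
    simpa using hasSum_prod_pow_div_factorial fun k => (x k : ℂ)
  exact sum_le_hasSum s (fun i _ => Finset.prod_nonneg fun k _ => by have := hx k; positivity) h

lemma sum_integral_norm_le {X ι : Type*} [MeasurableSpace X] {μ : Measure X}
    {F : ι → X → ℂ} {B : X → ℝ} (hF : ∀ i, AEStronglyMeasurable (F i) μ) (hB : Integrable B μ)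
    (h : ∀ (s : Finset ι) w, ∑ i ∈ s, ‖F i w‖ ≤ B w) :
    (∀ i, Integrable (F i) μ) ∧ ∀ s : Finset ι, ∑ i ∈ s, ∫ w, ‖F i w‖ ∂μ ≤ ∫ w, B w ∂μ := by
  have hi : ∀ i, Integrable (F i) μ := fun i =>
    hB.mono' (hF i) (.of_forall fun w => by simpa using h {i} w)
  refine ⟨hi, fun s => ?_⟩
  rw [← integral_finsetSum _ fun i _ => (hi i).norm]
  exact integral_mono (integrable_finsetSum _ fun i _ => (hi i).norm) hB (h s)

lemma hasSum_integral_of_sum_norm_le {X ι : Type*} [MeasurableSpace X] [Countable ι]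
    {μ : Measure X} {F : ι → X → ℂ} {B : X → ℝ} {G : X → ℂ}
    (hF : ∀ i, AEStronglyMeasurable (F i) μ) (hB : Integrable B μ)
    (h : ∀ (s : Finset ι) w, ∑ i ∈ s, ‖F i w‖ ≤ B w) (hG : ∀ w, HasSum (fun i => F i w) (G w)) :
    HasSum (fun i => ∫ w, F i w ∂μ) (∫ w, G w ∂μ) := by
  obtain ⟨h1, h2⟩ := sum_integral_norm_le hF hB h
  have := hasSum_integral_of_summable_integral_norm h1
    (summable_of_sum_le (fun i => integral_nonneg fun w => norm_nonneg _) h2)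
  simpa only [(hG _).tsum_eq] using this

lemma taylorCoeff_mul_eq_integral {p : (Fin n → ℂ) → ℂ} (hp : SubGauss p)
    (hd : Differentiable ℂ p) (i : Fin n → ℕ) (ζ : Fin n → ℂ) :
    taylorCoeff p i * ∏ k, ζ k ^ i k
      = ∫ w, p w * ∏ k, (ζ k * conj (w k)) ^ i k / ((i k).factorial : ℂ) ∂(gaussian n) := by
  rw [taylorCoeff, multiDeriv_eq_integral hp hd, div_mul_eq_mul_div, mul_div_assoc,
    ← integral_mul_const]
  simp only [zero_add, Finset.prod_div_distrib, mul_pow, Finset.prod_mul_distrib]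
  exact integral_congr_ae (.of_forall fun w => by ring)

lemma growsAtMost_exp (c : ℝ) :
    GrowsAtMost c fun w : Fin n → ℂ => (Real.exp (c * normSq w) : ℂ) :=
  ⟨by fun_prop, 1, fun w => by simp [-Complex.ofReal_exp]⟩

/-- The Taylor expansion at `0`, with a bound on its absolute partial sums. -/
lemma hasSum_taylorCoeff {p : (Fin n → ℂ) → ℂ} (hp : SubGauss p) (hd : Differentiable ℂ p) :
    (∀ ζ, HasSum (fun i => taylorCoeff p i * ∏ k, ζ k ^ i k) (p ζ)) ∧
    ∃ C : ℝ, ∀ (s : Finset (Fin n → ℕ)) (ζ : Fin n → ℂ),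
      ∑ i ∈ s, ‖taylorCoeff p i * ∏ k, ζ k ^ i k‖ ≤ C * Real.exp (3 / 8 * normSq ζ) := by
  set B : (Fin n → ℂ) → (Fin n → ℂ) → ℝ := fun ζ w =>
    ‖p w * Real.exp (2 / 3 * normSq w)‖ * Real.exp (3 / 8 * normSq ζ) with hBdef
  have hB : ∀ ζ, Integrable (B ζ) (gaussian n) := fun ζ =>
    ((hp.mul_growsAtMost (growsAtMost_exp (2 / 3)) (d := 3 / 4)
      (by norm_num)).integrable (by norm_num)).norm.mul_const _
  have hm : ∀ (ζ : Fin n → ℂ) (i : Fin n → ℕ), AEStronglyMeasurable (fun w => p w *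
      ∏ k, (ζ k * conj (w k)) ^ i k / ((i k).factorial : ℂ)) (gaussian n) := fun ζ i => by
    have := hp.continuous
    exact Continuous.aestronglyMeasurable (by fun_prop)
  have hle : ∀ (ζ : Fin n → ℂ) (s : Finset (Fin n → ℕ)) w, ∑ i ∈ s,
      ‖p w * ∏ k, (ζ k * conj (w k)) ^ i k / ((i k).factorial : ℂ)‖ ≤ B ζ w := by
    intro ζ s w
    have h1 := sum_prod_pow_div_factorial_le s (x := fun k => ‖ζ k‖ * ‖w k‖) fun k => by positivity
    have h2 := sum_norm_mul_norm_le (c := 3 / 8) (by norm_num) ζ w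
    simp only [norm_mul, norm_prod, norm_div, norm_pow, RCLike.norm_conj, RCLike.norm_natCast,
      ← Finset.mul_sum, hBdef, Complex.norm_real, Real.norm_eq_abs, Real.abs_exp]
    rw [mul_assoc, ← Real.exp_add]
    gcongr
    refine h1.trans (Real.exp_le_exp.2 (h2.trans (le_of_eq ?_)))
    norm_num; ring
  refine ⟨fun ζ => ?_, ∫ w, ‖p w * Real.exp (2 / 3 * normSq w)‖ ∂(gaussian n), fun s ζ => ?_⟩
  · simp_rw [taylorCoeff_mul_eq_integral hp hd]
    rw [← hp.integral_mul_kernel hd ζ]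
    exact hasSum_integral_of_sum_norm_le (hm ζ) (hB ζ) (hle ζ) fun w =>
      (hasSum_prod_pow_div_factorial _).mul_left (p w)
  · simp_rw [taylorCoeff_mul_eq_integral hp hd]
    rw [← integral_mul_const]
    exact (Finset.sum_le_sum fun i _ => norm_integral_le_integral_norm _).trans
      ((sum_integral_norm_le (hm ζ) (hB ζ) (hle ζ)).2 s)

lemma hasSum_conjSubDerivTerm {p u : (Fin n → ℂ) → ℂ} (hp : SubGauss p) (hpd : Differentiable ℂ p)
    (hu : SubGauss u) (hud : Differentiable ℂ u) (z : Fin n → ℂ) :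
    HasSum (conjSubDerivTerm p u z)
      (∫ w, u (z + w) * p (fun k => conj (z k) - conj (w k)) ∂(gaussian n)) := by
  obtain ⟨hsum, C, hC⟩ := hasSum_taylorCoeff hp hpd
  have hterm : conjSubDerivTerm p u z = fun i => ∫ w, u (z + w) *
      (taylorCoeff p i * ∏ k, (conj (z k) - conj (w k)) ^ i k) ∂(gaussian n) := by
    funext i
    rw [conjSubDerivTerm, conjSubDerivPow_eq_integral hu hud, ← integral_const_mul]
    exact integral_congr_ae (.of_forall fun w => by ring)
  rw [hterm]
  have hg : Integrable (fun w => C * Real.exp (3 / 4 * normSq z) *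
      ‖u (z + w) * Real.exp (3 / 4 * normSq w)‖) (gaussian n) :=
    (((hu.comp_add_left z).mul_growsAtMost (growsAtMost_exp (3 / 4)) (d := 7 / 8)
      (by norm_num)).integrable (by norm_num)).norm.const_mul _
  refine hasSum_integral_of_sum_norm_le (fun i => ?_) hg (fun s w => ?_) fun w =>
    (hsum _).mul_left (u (z + w))
  · have := hu.continuous
    exact Continuous.aestronglyMeasurable (by fun_prop)
  · have h1 := hC s fun k => conj (z k) - conj (w k)
    have hC0 : 0 ≤ C := by simpa [normSq] using (hC ∅ 0)
    have h2 : normSq (fun k => conj (z k) - conj (w k)) ≤ 2 * normSq z + 2 * normSq w := by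
      simpa [normSq, ← map_sub] using normSq_sub_le z w
    simp only [norm_mul (u (z + w)), ← Finset.mul_sum, Complex.norm_real, Real.norm_eq_abs,
      Real.abs_exp]
    calc ‖u (z + w)‖ * ∑ i ∈ s, ‖taylorCoeff p i * ∏ k, (conj (z k) - conj (w k)) ^ i k‖
        ≤ ‖u (z + w)‖ * (C * Real.exp (3 / 4 * normSq z + 3 / 4 * normSq w)) := by
          gcongr
          refine h1.trans ?_
          gcongr
          linarith
      _ = _ := by rw [Real.exp_add]; ring

/-- Coordinatewise complex conjugation. -/
def conjVec (z : Fin n → ℂ) : Fin n → ℂ := fun k => conj (z k)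

@[simp] lemma conjVec_conjVec (z : Fin n → ℂ) : conjVec (conjVec z) = z := by
  funext k; simp [conjVec]

@[simp] lemma normSq_conjVec (z : Fin n → ℂ) : normSq (conjVec z) = normSq z := normSq_conj z

@[fun_prop] lemma continuous_conjVec : Continuous (conjVec : (Fin n → ℂ) → Fin n → ℂ) := by
  unfold conjVec; fun_prop

lemma starFun_apply (g : (Fin n → ℂ) → ℂ) (z : Fin n → ℂ) : starFun g z = conj (g (conjVec z)) :=
  rfl

lemma starFun_conjVec (g : (Fin n → ℂ) → ℂ) (z : Fin n → ℂ) : starFun g (conjVec z) = conj (g z) := by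
  rw [starFun_apply, conjVec_conjVec]

lemma differentiable_starFun {g : (Fin n → ℂ) → ℂ} (hg : Differentiable ℂ g) :
    Differentiable ℂ (starFun g) := by
  intro z
  set L := fderiv ℂ g (conjVec z)
  have hc : HasFDerivAt (conjVec : (Fin n → ℂ) → Fin n → ℂ)
      (ContinuousLinearMap.pi fun k => Complex.conjCLE.toContinuousLinearMap.comp
        (ContinuousLinearMap.proj (R := ℝ) (φ := fun _ : Fin n => ℂ) k)) z :=
    hasFDerivAt_pi.2 fun k => (Complex.conjCLE.toContinuousLinearMap.comp
        (ContinuousLinearMap.proj (R := ℝ) (φ := fun _ : Fin n => ℂ) k)).hasFDerivAt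
  have hL : HasFDerivAt g (L.restrictScalars ℝ) (conjVec z) :=
    (hg (conjVec z)).hasFDerivAt.restrictScalars ℝ
  have h := Complex.conjCLE.toContinuousLinearMap.hasFDerivAt.comp z (hL.comp z hc)
  refine (hasFDerivAt_of_restrictScalars ℝ h (f' := ∑ k, conj (L (Pi.single k 1)) •
    ContinuousLinearMap.proj (R := ℂ) (φ := fun _ : Fin n => ℂ) k) ?_).differentiableAt
  ext v
  have hv : L (conjVec v) = ∑ k, conj (v k) * L (Pi.single k 1) := by
    have h1 := L.toLinearMap.pi_apply_eq_sum_univ (conjVec v)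
    have h2 : ∀ k : Fin n, (fun j => if k = j then (1 : ℂ) else 0) = Pi.single k 1 := fun k => by
      funext j; simp [Pi.single_apply, eq_comm]
    simpa [conjVec, h2] using h1
  have hv2 : L (fun k => conj (v k)) = ∑ k, conj (v k) * L (Pi.single k 1) := hv
  simp [hv2, mul_comm]

lemma SubGauss.starFun {g : (Fin n → ℂ) → ℂ} (hg : SubGauss g) : SubGauss (starFun g) :=
  (hg.comp continuous_conjVec one_pos (b := 0) fun z => by simp).conjugate

lemma integral_gaussian_comp_conjVec {G : (Fin n → ℂ) → ℂ} (hG : Differentiable ℂ G)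
    (hi : Integrable (fun w => G (conjVec w)) (gaussian n)) :
    ∫ w, G (conjVec w) ∂(gaussian n) = G 0 := by
  have h := integral_gaussian_eq_apply_zero (differentiable_starFun hG)
    ((Complex.conjLIE.toContinuousLinearEquiv : ℂ →L[ℝ] ℂ).integrable_comp hi)
  have h0 : conjVec (0 : Fin n → ℂ) = 0 := by funext; simp [conjVec]
  simp only [starFun_apply, integral_conj, h0] at h
  exact (starRingEnd ℂ).injective h

/-- A function of `(z, b)` that is entire on complex lines and vanishes for `b = z̄` is zero. -/
lemma eq_zero_of_apply_conjVec_eq_zero {F : (Fin n → ℂ) → (Fin n → ℂ) → ℂ}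
    (hF : ∀ z z' b b', Differentiable ℂ fun t : ℂ => F (z + t • z') (b + t • b'))
    (h0 : ∀ z, F z (conjVec z) = 0) (z b : Fin n → ℂ) : F z b = 0 := by
  set p : Fin n → ℂ := fun k => (z k + conj (b k)) / 2
  set q : Fin n → ℂ := fun k => (z k - conj (b k)) / (2 * Complex.I)
  have hd := hF p q (conjVec p) (conjVec q)
  have han : AnalyticOnNhd ℂ (fun t : ℂ => F (p + t • q) (conjVec p + t • conjVec q)) Set.univ :=
    hd.differentiableOn.analyticOnNhd isOpen_univ
  have hlim : Filter.Tendsto (fun m : ℕ => (((1 : ℝ) / ((m : ℝ) + 1) : ℝ) : ℂ)) Filter.atTop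
      (nhdsWithin 0 {0}ᶜ) := by
    rw [tendsto_nhdsWithin_iff]
    refine ⟨by simpa [Function.comp_def] using
      (Complex.continuous_ofReal.tendsto 0).comp (tendsto_one_div_add_atTop_nhds_zero_nat (𝕜 := ℝ)),
      .of_forall fun m => ?_⟩
    have : (m : ℂ) + 1 ≠ 0 := by exact_mod_cast m.succ_ne_zero
    simpa using this
  have hfreq : ∃ᶠ t : ℂ in nhdsWithin 0 {0}ᶜ,
      F (p + t • q) (conjVec p + t • conjVec q) = (fun _ => 0) t := by
    refine hlim.frequently (.of_forall fun m => ?_)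
    have := h0 (p + (((1 : ℝ) / ((m : ℝ) + 1) : ℝ) : ℂ) • q)
    convert this using 2
    funext k
    simp only [conjVec, Pi.add_apply, Pi.smul_apply, smul_eq_mul, map_add, map_mul,
      Complex.conj_ofReal]
  have h1 := congrFun (han.eq_of_frequently_eq analyticOnNhd_const hfreq) Complex.I
  have hz : p + Complex.I • q = z := by
    funext k
    simp only [p, q, Pi.add_apply, Pi.smul_apply, smul_eq_mul]
    field_simp
    ring
  have hb : conjVec p + Complex.I • conjVec q = b := by
    funext k
    simp only [p, q, conjVec, Pi.add_apply, Pi.smul_apply, smul_eq_mul, map_div₀, map_add, map_sub,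
      map_mul, Complex.conj_conj, Complex.conj_I, map_ofNat]
    field_simp
    ring
  simpa [hz, hb] using h1

/-- Entire functions of `(z, b)` that are `O(e^{c(|z|² + |b|²)})` for every `c > 0`. -/
structure EntireSubGauss (Φ : (Fin n → ℂ) → (Fin n → ℂ) → ℂ) : Prop where
  differentiable : Differentiable ℂ fun p : (Fin n → ℂ) × (Fin n → ℂ) => Φ p.1 p.2
  bound : ∀ c : ℝ, 0 < c → ∃ C : ℝ, 0 ≤ C ∧ ∀ z b, ‖Φ z b‖ ≤ C * Real.exp (c * (normSq z + normSq b))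

lemma EntireSubGauss.mul_left {u G : (Fin n → ℂ) → ℂ} (hu : SubGauss u) (hud : Differentiable ℂ u)
    (hG : SubGauss G) (hGd : Differentiable ℂ G) : EntireSubGauss fun z b => u z * G b := by
  refine ⟨by fun_prop, fun c hc => ?_⟩
  obtain ⟨C, hC0, hC⟩ := (hu c hc).nonneg_const
  obtain ⟨D, hD0, hD⟩ := (hG c hc).nonneg_const
  refine ⟨C * D, by positivity, fun z b => ?_⟩
  rw [norm_mul, mul_add, Real.exp_add]
  calc ‖u z‖ * ‖G b‖ ≤ (C * Real.exp (c * normSq z)) * (D * Real.exp (c * normSq b)) := by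
        gcongr; exacts [hC z, hD b]
    _ = _ := by ring

lemma EntireSubGauss.sub {Φ Ψ : (Fin n → ℂ) → (Fin n → ℂ) → ℂ} (hΦ : EntireSubGauss Φ)
    (hΨ : EntireSubGauss Ψ) : EntireSubGauss fun z b => Φ z b - Ψ z b := by
  refine ⟨hΦ.1.sub hΨ.1, fun c hc => ?_⟩
  obtain ⟨C, hC0, hC⟩ := hΦ.2 c hc
  obtain ⟨D, hD0, hD⟩ := hΨ.2 c hc
  refine ⟨C + D, by positivity, fun z b => (norm_sub_le _ _).trans ?_⟩
  rw [add_mul]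
  exact add_le_add (hC z b) (hD z b)

lemma EntireSubGauss.continuous_comp {Φ : (Fin n → ℂ) → (Fin n → ℂ) → ℂ} (hΦ : EntireSubGauss Φ)
    {X : Type*} [TopologicalSpace X] {f g : X → Fin n → ℂ} (hf : Continuous f) (hg : Continuous g) :
    Continuous fun x => Φ (f x) (g x) :=
  hΦ.differentiable.continuous.comp (hf.prodMk hg)

lemma EntireSubGauss.differentiable_comp {Φ : (Fin n → ℂ) → (Fin n → ℂ) → ℂ}
    (hΦ : EntireSubGauss Φ) {E : Type*} [NormedAddCommGroup E] [NormedSpace ℂ E]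
    {f g : E → Fin n → ℂ} (hf : Differentiable ℂ f) (hg : Differentiable ℂ g) :
    Differentiable ℂ fun x => Φ (f x) (g x) :=
  hΦ.differentiable.comp (hf.prodMk hg)

lemma EntireSubGauss.diag {Φ : (Fin n → ℂ) → (Fin n → ℂ) → ℂ} (hΦ : EntireSubGauss Φ) :
    SubGauss fun w => Φ w (conjVec w) := by
  intro c hc
  obtain ⟨C, -, hC⟩ := hΦ.2 (c / 2) (by positivity)
  refine ⟨hΦ.continuous_comp continuous_id continuous_conjVec, C, fun w => (hC _ _).trans_eq ?_⟩
  rw [normSq_conjVec]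
  ring_nf

/-- The function `(z, b) ↦ ∫ Φ(z + w, b + σ w̄) dμ(w)`. -/
def heat (σ : ℂ) (Φ : (Fin n → ℂ) → (Fin n → ℂ) → ℂ) (z b : Fin n → ℂ) : ℂ :=
  ∫ w, Φ (z + w) (b + σ • conjVec w) ∂(gaussian n)

lemma normSq_add_smul_le (z z' : Fin n → ℂ) {t : ℂ} {R : ℝ} (ht : ‖t‖ ≤ R) :
    normSq (z + t • z') ≤ 2 * normSq z + 2 * (R ^ 2 * normSq z') := by
  refine (normSq_add_le _ _).trans ?_
  rw [normSq_smul]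
  have := normSq_nonneg z'
  gcongr

lemma differentiable_heat {Φ : (Fin n → ℂ) → (Fin n → ℂ) → ℂ} (hΦ : EntireSubGauss Φ) {σ : ℂ}
    (hσ : ‖σ‖ = 1) (z z' b b' : Fin n → ℂ) :
    Differentiable ℂ fun t : ℂ => heat σ Φ (z + t • z') (b + t • b') := by
  refine differentiable_integral_of_dominated
    (fun w => hΦ.differentiable_comp (by fun_prop) (by fun_prop))
    (fun t => (hΦ.continuous_comp (by fun_prop) (by fun_prop)).aestronglyMeasurable) fun R => ?_
  obtain ⟨C, hC0, hC⟩ := hΦ.2 (1 / 8) (by norm_num)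
  set N := 2 * normSq z + 2 * (R ^ 2 * normSq z') + (2 * normSq b + 2 * (R ^ 2 * normSq b'))
  refine ⟨fun w => C * (Real.exp (N / 4) * Real.exp (1 / 2 * normSq w)),
    ((integrable_exp_mul_normSq (by norm_num)).const_mul _).const_mul _, fun t ht w =>
      (hC _ _).trans ?_⟩
  simp only [← Real.exp_add]
  gcongr
  have h1 := normSq_add_le (z + t • z') w
  have h2 := normSq_add_le (b + t • b') (σ • conjVec w)
  rw [normSq_smul, hσ, normSq_conjVec, one_pow, one_mul] at h2
  have h3 := normSq_add_smul_le z z' ht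
  have h4 := normSq_add_smul_le b b' ht
  simp only [N]
  linarith

/-- The rotation of `ℂⁿ × ℂⁿ` by `45°`. -/
def rotate : (Fin n → ℂ) × (Fin n → ℂ) →ₗ[ℝ] (Fin n → ℂ) × (Fin n → ℂ) :=
  (√2 : ℝ)⁻¹ • LinearMap.prod (LinearMap.fst ℝ _ _ - LinearMap.snd ℝ _ _)
    (LinearMap.fst ℝ _ _ + LinearMap.snd ℝ _ _)

lemma rotate_apply (p : (Fin n → ℂ) × (Fin n → ℂ)) :
    rotate p = ((√2 : ℝ)⁻¹ • (p.1 - p.2), (√2 : ℝ)⁻¹ • (p.1 + p.2)) := rfl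

@[fun_prop]
lemma continuous_rotate :
    Continuous (rotate : (Fin n → ℂ) × (Fin n → ℂ) → (Fin n → ℂ) × (Fin n → ℂ)) := by
  simp_rw [funext rotate_apply]
  fun_prop

lemma det_rotate_ne_zero : LinearMap.det (rotate (n := n)) ≠ 0 := by
  set S : (Fin n → ℂ) × (Fin n → ℂ) →ₗ[ℝ] (Fin n → ℂ) × (Fin n → ℂ) :=
    (√2 : ℝ)⁻¹ • LinearMap.prod (LinearMap.fst ℝ _ _ + LinearMap.snd ℝ _ _)
      (LinearMap.snd ℝ _ _ - LinearMap.fst ℝ _ _)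
  have h2 : (√2 : ℝ)⁻¹ * (√2 : ℝ)⁻¹ = 2⁻¹ := by
    rw [← mul_inv, Real.mul_self_sqrt (by norm_num)]
  have h : rotate ∘ₗ S = LinearMap.id := by
    refine LinearMap.ext fun p => ?_
    have hS : S p = ((√2 : ℝ)⁻¹ • (p.1 + p.2), (√2 : ℝ)⁻¹ • (p.2 - p.1)) := rfl
    rw [LinearMap.comp_apply, rotate_apply, hS, ← smul_sub, ← smul_add, smul_smul, smul_smul, h2]
    refine Prod.ext ?_ ?_ <;> simp only [LinearMap.id_apply] <;> module
  have hdet := congrArg LinearMap.det h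
  rw [LinearMap.det_comp, LinearMap.det_id] at hdet
  exact left_ne_zero_of_mul_eq_one hdet

lemma normSq_rotate (p : (Fin n → ℂ) × (Fin n → ℂ)) :
    normSq (rotate p).1 + normSq (rotate p).2 = normSq p.1 + normSq p.2 := by
  have h2 : (√2 : ℝ)⁻¹ ^ 2 = 2⁻¹ := by rw [inv_pow, Real.sq_sqrt (by norm_num)]
  simp only [rotate_apply, normSq, ← Finset.sum_add_distrib, Pi.smul_apply, norm_smul, mul_pow,
    norm_inv, Real.norm_eq_abs, abs_of_nonneg (Real.sqrt_nonneg 2), h2, Pi.sub_apply, Pi.add_apply]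
  refine Finset.sum_congr rfl fun k _ => ?_
  have := parallelogram_law_with_norm ℝ (p.1 k) (p.2 k)
  linarith

lemma measurePreserving_rotate :
    MeasurePreserving (rotate (n := n)) ((gaussian n).prod (gaussian n))
      ((gaussian n).prod (gaussian n)) := by
  set ρ : (Fin n → ℂ) × (Fin n → ℂ) → ENNReal := fun p =>
    ENNReal.ofReal ((Real.pi ^ n)⁻¹ * Real.exp (-normSq p.1)) *
      ENNReal.ofReal ((Real.pi ^ n)⁻¹ * Real.exp (-normSq p.2)) with hρdef
  have hρm : Measurable ρ := (measurable_gaussian_density.comp measurable_fst).mul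
    (measurable_gaussian_density.comp measurable_snd)
  have hprod : (gaussian n).prod (gaussian n) = volume.withDensity ρ :=
    prod_withDensity measurable_gaussian_density measurable_gaussian_density
  have hρ : ∀ p, ρ (rotate p) = ρ p := fun p => by
    simp only [hρdef]
    rw [← ENNReal.ofReal_mul (by positivity), ← ENNReal.ofReal_mul (by positivity)]
    have h := normSq_rotate p
    have he : Real.exp (-normSq (rotate p).1) * Real.exp (-normSq (rotate p).2)
        = Real.exp (-normSq p.1) * Real.exp (-normSq p.2) := by
      rw [← Real.exp_add, ← Real.exp_add]
      congr 1
      linarith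
    congr 1
    linear_combination (Real.pi ^ n)⁻¹ * (Real.pi ^ n)⁻¹ * he
  have hhaar : (volume : Measure ((Fin n → ℂ) × (Fin n → ℂ))).IsAddHaarMeasure := by
    exact Measure.prod.instIsAddHaarMeasure volume volume
  have hvol := Measure.map_linearMap_addHaar_eq_smul_addHaar
    (volume : Measure ((Fin n → ℂ) × (Fin n → ℂ))) (det_rotate_ne_zero (n := n))
  set c := ENNReal.ofReal |(LinearMap.det (rotate (n := n)))⁻¹|
  have hmap : ((gaussian n).prod (gaussian n)).map rotate
      = c • (gaussian n).prod (gaussian n) := by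
    ext s hs
    rw [Measure.map_apply continuous_rotate.measurable hs, hprod, Measure.smul_apply,
      withDensity_apply _ hs, withDensity_apply _ (continuous_rotate.measurable hs),
      ← lintegral_smul_measure, ← Measure.restrict_smul, ← hvol,
      setLIntegral_map hs hρm continuous_rotate.measurable]
    simp_rw [hρ]
  have hc : c = 1 := by
    have h := congrArg (fun m => m Set.univ) hmap
    rw [Measure.map_apply continuous_rotate.measurable MeasurableSet.univ] at h
    simpa using h.symm
  exact ⟨continuous_rotate.measurable, by rw [hmap, hc, one_smul]⟩

lemma integrable_prod_of_bound {H : (Fin n → ℂ) × (Fin n → ℂ) → ℂ} (hH : Continuous H) {C : ℝ}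
    (h : ∀ p, ‖H p‖ ≤ C * Real.exp (1 / 2 * (normSq p.1 + normSq p.2))) :
    Integrable H ((gaussian n).prod (gaussian n)) := by
  have hi : Integrable (fun w : Fin n → ℂ => Real.exp (1 / 2 * normSq w)) (gaussian n) :=
    integrable_exp_mul_normSq (by norm_num)
  refine ((hi.mul_prod hi).const_mul C).mono' hH.aestronglyMeasurable (.of_forall fun p => ?_)
  rw [← Real.exp_add, ← mul_add]
  exact h p

lemma heat_neg_heat {Φ : (Fin n → ℂ) → (Fin n → ℂ) → ℂ} (hΦ : EntireSubGauss Φ) {σ : ℂ}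
    (hσ : ‖σ‖ = 1) (z b : Fin n → ℂ) : heat (-σ) (heat σ Φ) z b = Φ z b := by
  obtain ⟨C, hC0, hC⟩ := hΦ.2 (1 / 16) (by norm_num)
  set H : (Fin n → ℂ) × (Fin n → ℂ) → ℂ := fun p =>
    Φ (z + (p.1 + p.2)) (b + σ • conjVec (p.2 - p.1))
  have hHc : Continuous H := hΦ.continuous_comp (by fun_prop) (by fun_prop)
  have hHb : ∀ p, ‖H p‖ ≤ C * Real.exp (1 / 8 * (normSq z + normSq b)) *
      Real.exp (1 / 2 * (normSq p.1 + normSq p.2)) := by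
    intro p
    refine (hC _ _).trans ?_
    rw [mul_assoc, ← Real.exp_add]
    gcongr
    have h1 := normSq_add_le z (p.1 + p.2)
    have h2 := normSq_add_le b (σ • conjVec (p.2 - p.1))
    rw [normSq_smul, hσ, normSq_conjVec, one_pow, one_mul] at h2
    have h3 := normSq_add_le p.1 p.2
    have h4 := normSq_sub_le p.2 p.1
    linarith
  have hi := integrable_prod_of_bound hHc hHb
  have hi2 : Integrable (H ∘ rotate) ((gaussian n).prod (gaussian n)) :=
    measurePreserving_rotate.integrable_comp_of_integrable hi
  have h1 : heat (-σ) (heat σ Φ) z b = ∫ p, H p ∂((gaussian n).prod (gaussian n)) := by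
    rw [integral_prod _ hi]
    refine integral_congr_ae (.of_forall fun w => integral_congr_ae (.of_forall fun w' => ?_))
    simp only [H]
    congr 1
    · abel
    · funext k
      simp only [conjVec, Pi.add_apply, Pi.smul_apply, Pi.sub_apply, smul_eq_mul, map_sub]
      ring
  have h2 : ∫ p, H p ∂((gaussian n).prod (gaussian n))
      = ∫ p, H (rotate p) ∂((gaussian n).prod (gaussian n)) := by
    conv_lhs => rw [← measurePreserving_rotate.map_eq]
    exact integral_map continuous_rotate.aemeasurable hHc.aestronglyMeasurable
  have hs2 : (√2 : ℝ)⁻¹ * 2 = √2 := by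
    rw [inv_mul_eq_div, div_eq_iff (by positivity), Real.mul_self_sqrt (by norm_num)]
  have h3 : ∀ p, H (rotate p) = Φ (z + (√2 : ℂ) • p.1) (b + (σ * (√2 : ℂ)) • conjVec p.2) := by
    intro p
    have hs2' : ((√2 : ℝ) : ℂ)⁻¹ * 2 = (√2 : ℝ) := by exact_mod_cast hs2
    simp only [H, rotate_apply]
    congr 1 <;> funext k <;>
      simp only [conjVec, Pi.add_apply, Pi.smul_apply, Pi.sub_apply, smul_eq_mul, map_sub, map_add,
        Complex.real_smul, map_mul, map_inv₀, Complex.conj_ofReal, Complex.ofReal_inv]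
    · linear_combination p.1 k * hs2'
    · linear_combination σ * conj (p.2 k) * hs2'
  have hi3 : Integrable (fun p : (Fin n → ℂ) × (Fin n → ℂ) =>
      Φ (z + (√2 : ℂ) • p.1) (b + (σ * (√2 : ℂ)) • conjVec p.2))
      ((gaussian n).prod (gaussian n)) := by
    simpa only [Function.comp_def, h3] using hi2
  have hsq : ‖(√2 : ℂ)‖ ^ 2 = 2 := by
    rw [Complex.norm_real, Real.norm_of_nonneg (Real.sqrt_nonneg 2), Real.sq_sqrt (by norm_num)]
  have hg : ∀ (y : Fin n → ℂ) (τ : ℂ), ‖τ‖ ^ 2 = 2 → ∀ w : Fin n → ℂ,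
      normSq (y + τ • w) ≤ 2 * normSq y + 4 * normSq w := by
    intro y τ hτ w
    have := normSq_add_le y (τ • w)
    rw [normSq_smul, hτ] at this
    linarith
  rw [h1, h2]
  simp_rw [h3]
  rw [integral_prod _ hi3]
  have h4 : ∀ s : Fin n → ℂ,
      ∫ t, Φ (z + (√2 : ℂ) • s) (b + (σ * (√2 : ℂ)) • conjVec t) ∂(gaussian n)
        = Φ (z + (√2 : ℂ) • s) b := by
    intro s
    have hint : Integrable (fun t =>
        Φ (z + (√2 : ℂ) • s) (b + (σ * (√2 : ℂ)) • conjVec t)) (gaussian n) := by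
      refine GrowsAtMost.integrable (c := 1 / 4) ⟨hΦ.continuous_comp (by fun_prop) (by fun_prop),
        C * Real.exp (1 / 16 * (normSq (z + (√2 : ℂ) • s) + 2 * normSq b)), fun t =>
        (hC _ _).trans ?_⟩ (by norm_num)
      rw [mul_assoc, ← Real.exp_add]
      gcongr
      have := hg b (σ * (√2 : ℂ)) (by rw [norm_mul, hσ, one_mul, hsq]) (conjVec t)
      rw [normSq_conjVec] at this
      linarith
    have := integral_gaussian_comp_conjVec
      (G := fun y => Φ (z + (√2 : ℂ) • s) (b + (σ * (√2 : ℂ)) • y))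
      (hΦ.differentiable_comp (by fun_prop) (by fun_prop)) hint
    simpa using this
  simp_rw [h4]
  have hint : Integrable (fun s => Φ (z + (√2 : ℂ) • s) b) (gaussian n) := by
    refine GrowsAtMost.integrable (c := 1 / 4) ⟨hΦ.continuous_comp (by fun_prop) (by fun_prop),
      C * Real.exp (1 / 16 * (2 * normSq z + normSq b)), fun s => (hC _ _).trans ?_⟩ (by norm_num)
    rw [mul_assoc, ← Real.exp_add]
    gcongr
    have := hg z (√2 : ℂ) hsq s
    linarith
  have := integral_gaussian_eq_apply_zero (G := fun s => Φ (z + (√2 : ℂ) • s) b)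
      (hΦ.differentiable_comp (by fun_prop) (by fun_prop)) hint
  simpa using this

lemma heat_neg_apply_conjVec {Φ : (Fin n → ℂ) → (Fin n → ℂ) → ℂ} (hΦ : EntireSubGauss Φ) {σ : ℂ}
    (hσ : ‖σ‖ = 1) (h : ∀ z, heat σ Φ z (conjVec z) = Φ z (conjVec z)) (z b : Fin n → ℂ) :
    heat (-σ) Φ z b = Φ z b := by
  have h1 : heat σ Φ = Φ := by
    funext z b
    refine sub_eq_zero.1 (eq_zero_of_apply_conjVec_eq_zero
      (F := fun z b => heat σ Φ z b - Φ z b) (fun z z' b b' => ?_)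
      (fun z => sub_eq_zero.2 (h z)) z b)
    exact (differentiable_heat hΦ hσ z z' b b').sub
      (hΦ.differentiable_comp (by fun_prop) (by fun_prop))
  conv_lhs => rw [← h1]
  exact heat_neg_heat hΦ hσ z b

lemma norm_kernel_comm (z w : Fin n → ℂ) : ‖kernel z w‖ = ‖kernel w z‖ := by
  rw [← conj_kernel, RCLike.norm_conj]

lemma integral_norm_kernel_sq (z : Fin n → ℂ) :
    ∫ w, ‖kernel z w‖ ^ 2 ∂(gaussian n) = Real.exp (normSq z) := by
  have h := (SubGauss.kernel_right z).integral_mul_kernel (differentiable_kernel_left z) z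
  rw [kernel_self] at h
  have h2 : ∀ w, kernel w z * kernel z w = ((‖kernel z w‖ ^ 2 : ℝ) : ℂ) := fun w => by
    rw [← conj_kernel z w, mul_comm, Complex.mul_conj, Complex.normSq_eq_norm_sq]
  simp_rw [h2] at h
  rw [integral_complex_ofReal] at h
  exact_mod_cast h

lemma integrable_mul_kernel_of_memLp {h : (Fin n → ℂ) → ℂ} (hh : MemLp h 2 (gaussian n))
    (z : Fin n → ℂ) : Integrable (fun w => h w * kernel z w) (gaussian n) :=
  hh.integrable_mul (SubGauss.kernel_left z).memLp

lemma growsAtMost_of_mem_fockSpace {h : (Fin n → ℂ) → ℂ} (hh : h ∈ fockSpace n) :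
    GrowsAtMost (1 / 2) h := by
  obtain ⟨hL : MemLp h 2 (gaussian n), hd : Differentiable ℂ h⟩ := hh
  have hsq : Integrable (fun w => ‖h w‖ ^ 2) (gaussian n) := hL.integrable_norm_pow (by norm_num)
  have hksq : ∀ z : Fin n → ℂ, Integrable (fun w => ‖kernel z w‖ ^ 2) (gaussian n) := fun z =>
    (SubGauss.kernel_left z).memLp.integrable_norm_pow (by norm_num)
  refine ⟨hd.continuous, (∫ w, ‖h w‖ ^ 2 ∂(gaussian n) + 1) / 2, fun z => ?_⟩
  have hi := integrable_mul_kernel_of_memLp hL z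
  set l := Real.exp (1 / 2 * normSq z)
  have hl : 0 < l := Real.exp_pos _
  have hl2 : Real.exp (normSq z) = l * l := by rw [← Real.exp_add]; ring_nf
  calc ‖h z‖ = ‖∫ w, h w * kernel z w ∂(gaussian n)‖ := by rw [integral_mul_kernel hd hi]
    _ ≤ ∫ w, ‖h w * kernel z w‖ ∂(gaussian n) := norm_integral_le_integral_norm _
    _ ≤ ∫ w, (l / 2 * ‖h w‖ ^ 2 + l⁻¹ / 2 * ‖kernel z w‖ ^ 2) ∂(gaussian n) := by
        refine integral_mono hi.norm ((hsq.const_mul _).add ((hksq z).const_mul _)) fun w => ?_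
        have hid : l / 2 * ‖h w‖ ^ 2 + l⁻¹ / 2 * ‖kernel z w‖ ^ 2 - ‖h w‖ * ‖kernel z w‖
            = l / 2 * (‖h w‖ - l⁻¹ * ‖kernel z w‖) ^ 2 := by
          field_simp; ring
        have : 0 ≤ l / 2 * (‖h w‖ - l⁻¹ * ‖kernel z w‖) ^ 2 := by positivity
        simp only [norm_mul]
        linarith
    _ = _ := by
        rw [integral_add (hsq.const_mul _) ((hksq z).const_mul _), integral_const_mul,
          integral_const_mul, integral_norm_kernel_sq, hl2]
        field_simp

lemma integral_mul_integral_mul_kernel {A B : (Fin n → ℂ) → ℂ} (hA : GrowsAtMost (1 / 8) A)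
    (hB : GrowsAtMost (5 / 8) B) :
    ∫ w, A w * ∫ a, B a * kernel w a ∂(gaussian n) ∂(gaussian n)
      = ∫ a, B a * ∫ w, A w * kernel w a ∂(gaussian n) ∂(gaussian n) := by
  have hAc := hA.1
  have hBc := hB.1
  have hA' : Integrable (fun w => A w * (Real.exp (3 / 4 * normSq w) : ℂ)) (gaussian n) :=
    (hA.mul (growsAtMost_exp (3 / 4))).integrable (by norm_num)
  have hB' : Integrable (fun w => B w * (Real.exp (1 / 3 * normSq w) : ℂ)) (gaussian n) :=
    (hB.mul (growsAtMost_exp (1 / 3))).integrable (by norm_num)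
  have hint : Integrable (Function.uncurry fun w a => A w * (B a * kernel w a))
      ((gaussian n).prod (gaussian n)) := by
    refine (hA'.mul_prod hB').mono
      (Continuous.aestronglyMeasurable (by unfold Function.uncurry; fun_prop))
      (.of_forall fun p => ?_)
    have hk := norm_kernel_le (c := 3 / 4) (by norm_num) p.1 p.2
    rw [Real.exp_add] at hk
    norm_num at hk
    simp only [Function.uncurry, norm_mul, Complex.norm_real, Real.norm_eq_abs, Real.abs_exp]
    calc ‖A p.1‖ * (‖B p.2‖ * ‖kernel p.1 p.2‖) ≤ ‖A p.1‖ * (‖B p.2‖ *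
          (Real.exp (3 / 4 * normSq p.1) * Real.exp (1 / 3 * normSq p.2))) := by gcongr
      _ = _ := by ring
  simp_rw [← integral_const_mul]
  rw [integral_integral_swap hint]
  refine integral_congr_ae (.of_forall fun a => integral_congr_ae (.of_forall fun w => ?_))
  simp only
  ring

section Toeplitz

variable {f g u v : (Fin n → ℂ) → ℂ}

lemma integral_mul_kernel_kernel (hf : SubGauss f) (hfd : Differentiable ℂ f) (z s : Fin n → ℂ) :
    ∫ w, f w * (kernel z w * kernel w s) ∂(gaussian n) = f z * kernel z s := by
  rw [← (hf.mul (.kernel_right s)).integral_mul_kernel (hfd.mul (differentiable_kernel_left s)) z]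
  exact integral_congr_ae (.of_forall fun w => by simp only; ring)

lemma integral_conj_mul_kernel_kernel (hg : SubGauss g) (hgd : Differentiable ℂ g)
    (z s : Fin n → ℂ) :
    ∫ w, conj (g w) * (kernel z w * kernel w s) ∂(gaussian n) = conj (g s) * kernel z s := by
  rw [← conj_kernel s z, ← map_mul, ← integral_mul_kernel_kernel hg hgd s z, ← integral_conj]
  refine integral_congr_ae (.of_forall fun w => ?_)
  simp only [map_mul, conj_kernel]
  ring

lemma SubGauss.integrable_mul_kernel_kernel (hf : SubGauss f) (z s : Fin n → ℂ) :
    Integrable (fun w => f w * (kernel z w * kernel w s)) (gaussian n) :=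
  (hf.mul ((SubGauss.kernel_left z).mul (.kernel_right s))).integrable

lemma toeplitz_kernel (hf : SubGauss f) (hfd : Differentiable ℂ f) (hg : SubGauss g)
    (hgd : Differentiable ℂ g) (s : Fin n → ℂ) :
    toeplitz (fun w => f w + conj (g w)) (fun w => kernel w s)
      = fun z => (f z + conj (g s)) * kernel z s := by
  funext z
  rw [add_mul, ← integral_mul_kernel_kernel hf hfd z s, ← integral_conj_mul_kernel_kernel hg hgd z s,
    ← integral_add (hf.integrable_mul_kernel_kernel z s) (hg.conjugate.integrable_mul_kernel_kernel z s)]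
  exact integral_congr_ae (.of_forall fun w => by simp only; ring)

lemma toeplitz_toeplitz (hf : SubGauss f) (hfd : Differentiable ℂ f) (hg : SubGauss g)
    (hgd : Differentiable ℂ g) {ψ h : (Fin n → ℂ) → ℂ} (hψ : SubGauss ψ)
    (hh : GrowsAtMost (1 / 2) h) (z : Fin n → ℂ) :
    toeplitz (fun w => f w + conj (g w)) (toeplitz ψ h) z
      = ∫ a, h a * (ψ a * (f z + conj (g a)) * kernel z a) ∂(gaussian n) := by
  have hA : GrowsAtMost (1 / 8) fun w => (f w + conj (g w)) * kernel z w :=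
    (hf.add hg.conjugate).mul (.kernel_left z) _ (by norm_num)
  have hB : GrowsAtMost (5 / 8) fun a => ψ a * h a := hψ.mul_growsAtMost hh (by norm_num)
  calc toeplitz (fun w => f w + conj (g w)) (toeplitz ψ h) z
      = ∫ w, (f w + conj (g w)) * kernel z w * ∫ a, ψ a * h a * kernel w a ∂(gaussian n)
          ∂(gaussian n) := by
        refine integral_congr_ae (.of_forall fun w => ?_)
        simp only [toeplitz, proj]
        ring
    _ = ∫ a, ψ a * h a * ∫ w, (f w + conj (g w)) * kernel z w * kernel w a ∂(gaussian n)
          ∂(gaussian n) := integral_mul_integral_mul_kernel hA hB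
    _ = _ := by
        refine integral_congr_ae (.of_forall fun a => ?_)
        have h1 : ∫ w, (f w + conj (g w)) * kernel z w * kernel w a ∂(gaussian n)
            = (f z + conj (g a)) * kernel z a := by
          rw [← congrFun (toeplitz_kernel hf hfd hg hgd a) z]
          exact integral_congr_ae (.of_forall fun w => by simp only; ring)
        simp only [h1]
        ring

/-- The integral kernel of `[T_{f + ḡ}, T_{u + v̄}]` at `z`. -/
def commutatorKernel (f g u v : (Fin n → ℂ) → ℂ) (z a : Fin n → ℂ) : ℂ :=
  ((u a + conj (v a)) * (f z + conj (g a)) - (f a + conj (g a)) * (u z + conj (v a))) * kernel z a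

lemma subGauss_commutatorKernel (hf : SubGauss f) (hg : SubGauss g) (hu : SubGauss u)
    (hv : SubGauss v) (z : Fin n → ℂ) : SubGauss (commutatorKernel f g u v z) :=
  (((hu.add hv.conjugate).mul ((SubGauss.const (f z)).add hg.conjugate)).sub
    ((hf.add hg.conjugate).mul ((SubGauss.const (u z)).add hv.conjugate))).mul (.kernel_left z)

lemma toeplitz_commutator (hf : SubGauss f) (hfd : Differentiable ℂ f) (hg : SubGauss g)
    (hgd : Differentiable ℂ g) (hu : SubGauss u) (hud : Differentiable ℂ u) (hv : SubGauss v)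
    (hvd : Differentiable ℂ v) {h : (Fin n → ℂ) → ℂ} (hh : GrowsAtMost (1 / 2) h)
    (z : Fin n → ℂ) :
    toeplitz (fun w => f w + conj (g w)) (toeplitz (fun w => u w + conj (v w)) h) z
      - toeplitz (fun w => u w + conj (v w)) (toeplitz (fun w => f w + conj (g w)) h) z
      = ∫ a, commutatorKernel f g u v z a * h a ∂(gaussian n) := by
  have hint : ∀ {G : (Fin n → ℂ) → ℂ}, SubGauss G → Integrable (fun a => h a * G a) (gaussian n) :=
    fun hG => by
      simpa only [mul_comm] using (hG.mul_growsAtMost hh (d := 3 / 4) (by norm_num)).integrable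
        (by norm_num)
  rw [toeplitz_toeplitz hf hfd hg hgd (hu.add hv.conjugate) hh,
    toeplitz_toeplitz hu hud hv hvd (hf.add hg.conjugate) hh, ← integral_sub
      (hint (((hu.add hv.conjugate).mul ((SubGauss.const (f z)).add hg.conjugate)).mul
        (.kernel_left z)))
      (hint (((hf.add hg.conjugate).mul ((SubGauss.const (u z)).add hv.conjugate)).mul
        (.kernel_left z)))]
  refine integral_congr_ae (.of_forall fun a => ?_)
  simp only [commutatorKernel]
  ring

lemma integral_commutatorKernel_mul_kernel (hf : SubGauss f) (hfd : Differentiable ℂ f)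
    (hg : SubGauss g) (hgd : Differentiable ℂ g) (hu : SubGauss u) (hud : Differentiable ℂ u)
    (hv : SubGauss v) (hvd : Differentiable ℂ v) (z s : Fin n → ℂ) :
    ∫ a, commutatorKernel f g u v z a * kernel a s ∂(gaussian n)
      = ∫ a, (u a * conj (g a) - f a * conj (v a)) * (kernel z a * kernel a s) ∂(gaussian n)
        - (u z * conj (g s) - f z * conj (v s)) * kernel z s := by
  have hi := fun {G : (Fin n → ℂ) → ℂ} (hG : SubGauss G) => hG.integrable_mul_kernel_kernel z s
  have e1 : ∫ a, ((f z * (u a + conj (v a)) - u z * (f a + conj (g a)))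
        * (kernel z a * kernel a s)) ∂(gaussian n)
      = f z * (u z * kernel z s + conj (v s) * kernel z s)
        - u z * (f z * kernel z s + conj (g s) * kernel z s) := by
    rw [← integral_mul_kernel_kernel hu hud, ← integral_mul_kernel_kernel hf hfd,
      ← integral_conj_mul_kernel_kernel hg hgd, ← integral_conj_mul_kernel_kernel hv hvd,
      ← integral_add (hi hu) (hi hv.conjugate), ← integral_add (hi hf) (hi hg.conjugate),
      ← integral_const_mul, ← integral_const_mul]
    refine Eq.trans ?_ (integral_sub
      (((hi hu).add (hi hv.conjugate)).const_mul _) (((hi hf).add (hi hg.conjugate)).const_mul _))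
    exact integral_congr_ae (.of_forall fun a => by simp only; ring)
  have e2 : ∫ a, commutatorKernel f g u v z a * kernel a s ∂(gaussian n)
      = ∫ a, (u a * conj (g a) - f a * conj (v a)) * (kernel z a * kernel a s) ∂(gaussian n)
        + ∫ a, ((f z * (u a + conj (v a)) - u z * (f a + conj (g a)))
        * (kernel z a * kernel a s)) ∂(gaussian n) := by
    rw [← integral_add (hi ((hu.mul hg.conjugate).sub (hf.mul hv.conjugate)))
      (hi (((SubGauss.const (f z)).mul (hu.add hv.conjugate)).sub
        ((SubGauss.const (u z)).mul (hf.add hg.conjugate))))]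
    refine integral_congr_ae (.of_forall fun a => ?_)
    simp only [commutatorKernel]
    ring
  rw [e2, e1]
  ring

lemma berezin_eq (φ : (Fin n → ℂ) → ℂ) (z : Fin n → ℂ) :
    berezin φ z = ∫ w, φ (z + w) ∂(gaussian n) := by
  have h : ∀ w, φ w * normalizedKernel w z * conj (normalizedKernel w z)
      = (Real.exp (-normSq z) : ℂ) * (φ w * (kernel z w * kernel w z)) := by
    intro w
    have hs : ((√(kernel z z).re : ℝ) : ℂ) * ((√(kernel z z).re : ℝ) : ℂ)
        = (Real.exp (normSq z) : ℂ) := by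
      rw [kernel_self, Complex.ofReal_re, ← Complex.ofReal_mul,
        Real.mul_self_sqrt (Real.exp_pos _).le]
    rw [normalizedKernel, map_div₀, conj_kernel, Complex.conj_ofReal, mul_assoc, div_mul_div_comm,
      hs, Real.exp_neg, Complex.ofReal_inv]
    ring
  simp_rw [berezin, h]
  rw [integral_const_mul, integral_mul_kernel_mul_kernel, ← mul_assoc, ← Complex.ofReal_mul,
    ← Real.exp_add]
  simp

lemma heat_one_conjVec (Φ : (Fin n → ℂ) → (Fin n → ℂ) → ℂ) (z : Fin n → ℂ) :
    heat 1 Φ z (conjVec z) = berezin (fun w => Φ w (conjVec w)) z := by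
  rw [berezin_eq]
  refine integral_congr_ae (.of_forall fun w => ?_)
  simp only [one_smul]
  congr 1
  funext k
  simp [conjVec]

lemma kernel_conjVec (z b : Fin n → ℂ) : kernel z (conjVec b) = Complex.exp (∑ k, z k * b k) := by
  simp [kernel, pairing, conjVec]

lemma differentiable_integral_mul_kernel_kernel {φ : (Fin n → ℂ) → ℂ} (hφ : SubGauss φ)
    (z z' b b' : Fin n → ℂ) :
    Differentiable ℂ fun t : ℂ => ∫ w, φ w * (kernel (z + t • z') w *
      kernel w (conjVec (b + t • b'))) ∂(gaussian n) := by
  have hφc := hφ.continuous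
  refine differentiable_integral_of_dominated (fun w => ?_)
    (fun t => (hφ.integrable_mul_kernel_kernel _ _).1) fun R => ?_
  · simp only [kernel_conjVec]
    exact (((differentiable_kernel_left w).comp (by fun_prop)).mul (by fun_prop)).const_mul _
  · set N := 2 * normSq z + 2 * (R ^ 2 * normSq z') + (2 * normSq b + 2 * (R ^ 2 * normSq b'))
    have hi : Integrable (fun w => φ w * (Real.exp (1 / 2 * normSq w) : ℂ)) (gaussian n) :=
      (hφ.mul_growsAtMost (growsAtMost_exp (1 / 2)) (d := 3 / 4) (by norm_num)).integrable
        (by norm_num)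
    refine ⟨fun w => Real.exp N * ‖φ w * (Real.exp (1 / 2 * normSq w) : ℂ)‖,
      hi.norm.const_mul _, fun t ht w => ?_⟩
    have h1 := norm_kernel_le one_pos (z + t • z') w
    have h2 := norm_kernel_le one_pos (conjVec (b + t • b')) w
    rw [norm_kernel_comm, normSq_conjVec] at h2
    have h3 := normSq_add_smul_le z z' ht
    have h4 := normSq_add_smul_le b b' ht
    have h5 : ‖kernel (z + t • z') w‖ * ‖kernel w (conjVec (b + t • b'))‖
        ≤ Real.exp N * Real.exp (1 / 2 * normSq w) := by
      refine (mul_le_mul h1 h2 (norm_nonneg _) (Real.exp_pos _).le).trans ?_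
      rw [← Real.exp_add, ← Real.exp_add]
      refine Real.exp_le_exp.2 ?_
      simp only [N]
      linarith
    simp only [norm_mul, Complex.norm_real, Real.norm_eq_abs, Real.abs_exp]
    calc ‖φ w‖ * (‖kernel (z + t • z') w‖ * ‖kernel w (conjVec (b + t • b'))‖)
        ≤ ‖φ w‖ * (Real.exp N * Real.exp (1 / 2 * normSq w)) := by gcongr
      _ = _ := by ring

lemma integral_diag_mul_kernel_kernel {Φ : (Fin n → ℂ) → (Fin n → ℂ) → ℂ} (hΦ : EntireSubGauss Φ)
    (h : ∀ z, berezin (fun w => Φ w (conjVec w)) z = Φ z (conjVec z)) (z s : Fin n → ℂ) :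
    ∫ w, Φ w (conjVec w) * (kernel z w * kernel w s) ∂(gaussian n)
      = Φ z (conjVec s) * kernel z s := by
  have := eq_zero_of_apply_conjVec_eq_zero (F := fun z b =>
    ∫ w, Φ w (conjVec w) * (kernel z w * kernel w (conjVec b)) ∂(gaussian n)
      - Φ z b * kernel z (conjVec b)) (fun z z' b b' => ?_) (fun z => ?_) z (conjVec s)
  · simpa [sub_eq_zero] using this
  · refine (differentiable_integral_mul_kernel_kernel hΦ.diag z z' b b').sub
      ((hΦ.differentiable_comp (by fun_prop) (by fun_prop)).mul ?_)
    simp only [kernel_conjVec]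
    fun_prop
  · have h1 := h z
    rw [berezin_eq] at h1
    rw [conjVec_conjVec, integral_mul_kernel_mul_kernel (fun w => Φ w (conjVec w)), h1, kernel_self]
    ring

lemma kernel_mem_productDomain (hf : SubGauss f) (hg : SubGauss g) (hu : SubGauss u)
    (hud : Differentiable ℂ u) (hv : SubGauss v) (hvd : Differentiable ℂ v) (s : Fin n → ℂ) :
    (fun w => kernel w s) ∈ productDomain (fun w => f w + conj (g w))
      (fun w => u w + conj (v w)) := by
  have hT : SubGauss fun z => (u z + conj (v s)) * kernel z s :=
    (hu.add (.const _)).mul (.kernel_right s)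
  refine ⟨⟨⟨(SubGauss.kernel_right s).memLp, differentiable_kernel_left s⟩,
    ((hu.add hv.conjugate).mul (.kernel_right s)).memLp⟩, ?_⟩
  rw [toeplitz_kernel hu hud hv hvd]
  exact ⟨⟨hT.memLp, (hud.add_const _).mul (differentiable_kernel_left s)⟩,
    ((hf.add hg.conjugate).mul hT).memLp⟩

lemma commutatorEqZero_iff_berezin (hf : SubGauss f) (hfd : Differentiable ℂ f)
    (hg : SubGauss g) (hgd : Differentiable ℂ g) (hu : SubGauss u) (hud : Differentiable ℂ u)
    (hv : SubGauss v) (hvd : Differentiable ℂ v) :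
    CommutatorEqZero (fun z => f z + conj (g z)) (fun z => u z + conj (v z)) ↔
      berezin (fun z => u z * conj (g z) - f z * conj (v z))
        = fun z => u z * conj (g z) - f z * conj (v z) := by
  constructor
  · intro hcomm
    funext z
    have h1 := congrFun (hcomm _ ⟨kernel_mem_productDomain hf hg hu hud hv hvd z,
      kernel_mem_productDomain hu hv hf hfd hg hgd z⟩) z
    rw [Pi.sub_apply, toeplitz_commutator hf hfd hg hgd hu hud hv hvd
      (SubGauss.kernel_right z _ (by norm_num)), integral_commutatorKernel_mul_kernel hf hfd hg hgd
      hu hud hv hvd, integral_mul_kernel_mul_kernel (fun a => u a * conj (g a) - f a * conj (v a)),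
      kernel_self, mul_comm, ← sub_mul, Pi.zero_apply, mul_eq_zero] at h1
    rw [berezin_eq]
    exact sub_eq_zero.1 (h1.resolve_right (by simp))
  · rintro hB h ⟨hh, -⟩
    have hF : h ∈ fockSpace n := hh.1.1
    have hgr := growsAtMost_of_mem_fockSpace hF
    have hΦ : EntireSubGauss fun z b => u z * starFun g b - f z * starFun v b :=
      (EntireSubGauss.mul_left hu hud hg.starFun (differentiable_starFun hgd)).sub
        (EntireSubGauss.mul_left hf hfd hv.starFun (differentiable_starFun hvd))
    have hQ := integral_diag_mul_kernel_kernel hΦ (by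
      simpa only [starFun_conjVec] using congrFun hB)
    simp only [starFun_conjVec] at hQ
    funext z
    have hrep : ∀ a, h a = ∫ s, h s * kernel a s ∂(gaussian n) := fun a =>
      (integral_mul_kernel hF.2 (integrable_mul_kernel_of_memLp hF.1 a)).symm
    rw [Pi.sub_apply, toeplitz_commutator hf hfd hg hgd hu hud hv hvd hgr]
    conv_lhs => enter [2, a]; rw [hrep a]
    rw [integral_mul_integral_mul_kernel
      (subGauss_commutatorKernel hf hg hu hv z _ (by norm_num)) (hgr.mono (by norm_num))]
    simp [integral_commutatorKernel_mul_kernel hf hfd hg hgd hu hud hv hvd, hQ]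

end Toeplitz

lemma hasSum_conjSubDerivTerm_starFun {g u : (Fin n → ℂ) → ℂ} (hg : SubGauss g)
    (hgd : Differentiable ℂ g) (hu : SubGauss u) (hud : Differentiable ℂ u) (z : Fin n → ℂ) :
    HasSum (conjSubDerivTerm (starFun g) u z)
      (heat (-1) (fun z b => u z * starFun g b) z (conjVec z)) := by
  convert hasSum_conjSubDerivTerm hg.starFun (differentiable_starFun hgd) hu hud z using 1
  refine integral_congr_ae (.of_forall fun w => ?_)
  simp only [neg_smul, one_smul, ← sub_eq_add_neg]
  rfl

lemma heat_sub {Φ Ψ : (Fin n → ℂ) → (Fin n → ℂ) → ℂ} (hΦ : EntireSubGauss Φ)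
    (hΨ : EntireSubGauss Ψ) {σ : ℂ} (hσ : ‖σ‖ = 1) (z b : Fin n → ℂ) :
    heat σ (fun z b => Φ z b - Ψ z b) z b = heat σ Φ z b - heat σ Ψ z b := by
  have hi : ∀ {Φ : (Fin n → ℂ) → (Fin n → ℂ) → ℂ}, EntireSubGauss Φ →
      Integrable (fun w => Φ (z + w) (b + σ • conjVec w)) (gaussian n) := by
    intro Φ hΦ
    obtain ⟨C, hC0, hC⟩ := hΦ.2 (1 / 8) (by norm_num)
    refine GrowsAtMost.integrable (c := 1 / 2) ⟨hΦ.continuous_comp (by fun_prop) (by fun_prop),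
      C * Real.exp (1 / 4 * (normSq z + normSq b)), fun w => (hC _ _).trans ?_⟩ (by norm_num)
    rw [mul_assoc, ← Real.exp_add]
    gcongr
    have h1 := normSq_add_le z w
    have h2 := normSq_add_le b (σ • conjVec w)
    rw [normSq_smul, hσ, normSq_conjVec, one_pow, one_mul] at h2
    linarith
  exact integral_sub (hi hΦ) (hi hΨ)

end Fock

end

theorem mainTheorem4 (n : ℕ) (f g u v : (Fin n → ℂ) → ℂ)
    (hf : f ∈ Fock.Sym n ∩ Fock.entire n) (hg : g ∈ Fock.Sym n ∩ Fock.entire n)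
    (hu : u ∈ Fock.Sym n ∩ Fock.entire n) (hv : v ∈ Fock.Sym n ∩ Fock.entire n) :
    (∀ z, Summable (Fock.conjSubDerivTerm (Fock.starFun g) u z)) ∧
    (∀ z, Summable (Fock.conjSubDerivTerm (Fock.starFun v) f z)) ∧
    List.TFAE [
      Fock.CommutatorEqZero (fun z => f z + conj (g z)) (fun z => u z + conj (v z)),
      Fock.berezin (fun z => u z * conj (g z) - f z * conj (v z)) =
        fun z => u z * conj (g z) - f z * conj (v z),
      (fun z => u z * conj (g z) - f z * conj (v z)) =
        fun z => Fock.conjSubDeriv (Fock.starFun g) u z -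
          Fock.conjSubDeriv (Fock.starFun v) f z] := by
  have hfs := Fock.subGauss_of_mem hf
  have hgs := Fock.subGauss_of_mem hg
  have hus := Fock.subGauss_of_mem hu
  have hvs := Fock.subGauss_of_mem hv
  have hfd : Differentiable ℂ f := hf.2
  have hgd : Differentiable ℂ g := hg.2
  have hud : Differentiable ℂ u := hu.2
  have hvd : Differentiable ℂ v := hv.2
  have hsum1 := Fock.hasSum_conjSubDerivTerm_starFun hgs hgd hus hud
  have hsum2 := Fock.hasSum_conjSubDerivTerm_starFun hvs hvd hfs hfd
  refine ⟨fun z => (hsum1 z).summable, fun z => (hsum2 z).summable, ?_⟩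
  have hΦ1 := Fock.EntireSubGauss.mul_left hus hud hgs.starFun (Fock.differentiable_starFun hgd)
  have hΦ2 := Fock.EntireSubGauss.mul_left hfs hfd hvs.starFun (Fock.differentiable_starFun hvd)
  have hΦ := hΦ1.sub hΦ2
  have hone : ‖(1 : ℂ)‖ = 1 := norm_one
  have hneg : ‖(-1 : ℂ)‖ = 1 := by simp
  have hser : ∀ z, Fock.conjSubDeriv (Fock.starFun g) u z - Fock.conjSubDeriv (Fock.starFun v) f z
      = Fock.heat (-1) (fun z b => u z * Fock.starFun g b - f z * Fock.starFun v b) z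
        (Fock.conjVec z) := fun z => by
    rw [Fock.heat_sub hΦ1 hΦ2 hneg, ← (hsum1 z).tsum_eq, ← (hsum2 z).tsum_eq]
    rfl
  have hber := Fock.heat_one_conjVec fun z b => u z * Fock.starFun g b - f z * Fock.starFun v b
  simp only [Fock.starFun_conjVec] at hber
  tfae_have 1 ↔ 2 := Fock.commutatorEqZero_iff_berezin hfs hfd hgs hgd hus hud hvs hvd
  tfae_have 2 → 3 := fun h => by
    funext z
    rw [hser, Fock.heat_neg_apply_conjVec hΦ hone fun z => ?_]
    · simp only [Fock.starFun_conjVec]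
    · rw [hber, h]
      simp only [Fock.starFun_conjVec]
  tfae_have 3 → 2 := fun h => by
    funext z
    have h2 := Fock.heat_neg_apply_conjVec hΦ hneg (fun z => by
      rw [← hser, ← congrFun h z]
      simp only [Fock.starFun_conjVec]) z (Fock.conjVec z)
    rw [neg_neg, hber] at h2
    simpa only [Fock.starFun_conjVec] using h2
  tfae_finish
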